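/- Let $c>\pi^2$, let $x_0\in(0,1)$, and consider the pointwise controlled heat equation $$y_t-y_{xx}-cy=\delta(x-x_0)u(t)\ \text{ in }\mathbb{R}^+\times(0,1),\qquad y(t,0)=y(t,1)=0,\qquad y(0,\cdot)=y_0\in L^2(0,1),$$ that is, the system $y'=Ay+Bu$ with state space $X=L^2(0,1)$ (real-valued), control space $U=\mathbb{R}$, $Ay=y''+cy$ with $D(A)=H^2(0,1)\cap H^1_0(0,1)$, and $B\in\mathcal{L}(U;X_{-1})$, $Bu=\delta(\cdot-x_0)u$, where $X_{-1}$ is the dual of $D(A^*)$ (with the graph norm) with respect to the pivot space $X$. The system is called completely stabilizable if for every $\alpha>0$ there is a linear operator $K$ from a subspace $D(K)\supseteq D(A)$ of $X$ to $U$, with $K|_{D(A)}\in\mathcal{L}(D(A);U)$, such that (a) the operator $A_K:=A+BK$ (the sum being taken in $X_{-1}$, with $A$ extended to $X\to X_{-1}$), with domain $D(A_K):=\{x\in D(K): A_Kx\in X\}$, generates a $C_0$-semigroup $S_K(t)$, $t\ge 0$, on $X$; (b) there is $C>0$ such that $\|S_K(t)\|_{\mathcal{L}(X)}\le Ce^{-\alpha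 t}$ for all $t\ge 0$; (c) $K\in\mathcal{L}(D(A_K);U)$, where $D(A_K)$ carries the graph norm; (d) there is $D>0$ such that for each $y_0\in D(A_K)$ the control $u(t):=KS_K(t)y_0$ satisfies $\|u\|_{L^2(\mathbb{R}^+;U)}\le D\|y_0\|_X$. Then the system is completely stabilizable if and only if $x_0$ is irrational. -/

import Mathlib

open MeasureTheory Set Filter Topology
open scoped ContDiff

noncomputable section

/-! ### Stabilization of linear control systems with an unbounded control operator -/

section Abstract

variable {X U : Type*} [NormedAddCommGroup X] [InnerProductSpace ℝ X] [CompleteSpace X]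
  [NormedAddCommGroup U] [InnerProductSpace ℝ U]

/-- `S(t)`, `t ≥ 0`, is a `C₀`-semigroup of bounded operators on `X`. Values at negative times are
irrelevant. -/
structure IsC0Semigroup (S : ℝ → X →L[ℝ] X) : Prop where
  map_zero : S 0 = ContinuousLinearMap.id ℝ X
  map_add : ∀ s t : ℝ, 0 ≤ s → 0 ≤ t → S (s + t) = (S s).comp (S t)
  tendsto_zero : ∀ x : X, Tendsto (fun t : ℝ => S t x) (𝓝[>] 0) (𝓝 x)

/-- The operator with graph `{(x, z) | G x z}` is the infinitesimal generator of `S`: `x` is in the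
domain with image `z` exactly when `(S(t) x - x) / t → z` as `t ↓ 0`. -/
def IsGeneratorOf (G : X → X → Prop) (S : ℝ → X →L[ℝ] X) : Prop :=
  ∀ x z : X, G x z ↔ Tendsto (fun t : ℝ => t⁻¹ • (S t x - x)) (𝓝[>] 0) (𝓝 z)

/-- The extrapolation space `X₋₁`: the dual of `D(A*)` (with respect to the pivot space `X`). Here
`D(A*)` carries the graph norm, being identified with the graph of `A*` in `X × X`. -/
abbrev ExtrapolationSpace (A : X →ₗ.[ℝ] X) : Type _ := StrongDual ℝ A.adjoint.graph

/-- `IsClosedLoop A B K x z` says `x ∈ D(A_K)` and `A_K x = z`, where `A_K = A + B K` and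
`D(A_K) = {x : A_K x ∈ X}`. The sum is taken in `X₋₁`: the extension of `A` to `X` sends `x` to
`φ ↦ ⟪x, A* φ⟫`, and an element `z` of `X` is the functional `φ ↦ ⟪z, φ⟫`. The feedback operator
`K` may be unbounded, so `A_K x` makes sense only for `x` in the domain of `K`. -/
def IsClosedLoop (A : X →ₗ.[ℝ] X) (B : U →L[ℝ] ExtrapolationSpace A) (K : X →ₗ.[ℝ] U)
    (x z : X) : Prop :=
  ∃ hx : x ∈ K.domain, ∀ φ : A.adjoint.graph,
    inner ℝ x (φ : X × X).2 + B (K ⟨x, hx⟩) φ = inner ℝ z (φ : X × X).1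

/-- `K` is a feedback law for `y' = A y + B u` that stabilizes the system at rate `α`, and `S` is
the closed-loop semigroup. -/
structure IsStabilizingFeedback (A : X →ₗ.[ℝ] X) (B : U →L[ℝ] ExtrapolationSpace A)
    (α : ℝ) (K : X →ₗ.[ℝ] U) (S : ℝ → X →L[ℝ] X) : Prop where
  /-- `K` is defined on `D(A)`. -/
  domain_le : A.domain ≤ K.domain
  /-- `K ∈ 𝓛(D(A); U)`. -/
  bounded_domain : ∃ M : ℝ, ∀ (x : A.domain) (hx : (x : X) ∈ K.domain),
    ‖K ⟨x, hx⟩‖ ≤ M * (‖(x : X)‖ + ‖A x‖)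
  /-- `S` is a `C₀`-semigroup. -/
  semigroup : IsC0Semigroup S
  /-- `A_K` generates `S`. -/
  generator : IsGeneratorOf (IsClosedLoop A B K) S
  /-- `S` decays at rate `α`. -/
  decay : ∃ C : ℝ, 0 < C ∧ ∀ t : ℝ, 0 ≤ t → ‖S t‖ ≤ C * Real.exp (-α * t)
  /-- `K ∈ 𝓛(D(A_K); U)`. -/
  bounded_closedLoop : ∃ M : ℝ, ∀ (x z : X) (hx : x ∈ K.domain), IsClosedLoop A B K x z →
    ‖K ⟨x, hx⟩‖ ≤ M * (‖x‖ + ‖z‖)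
  /-- For `y₀ ∈ D(A_K)` the control `u(t) = K S(t) y₀` is in `L²(ℝ⁺; U)` with norm at most
  `D ‖y₀‖`. -/
  control_bound : ∃ D : ℝ, 0 < D ∧ ∀ y₀ z₀ : X, IsClosedLoop A B K y₀ z₀ →
    ∃ u : ℝ → U, (∀ t : ℝ, 0 ≤ t → (S t y₀, u t) ∈ K.graph) ∧
      MemLp u 2 (volume.restrict (Ioi 0)) ∧
      eLpNorm u 2 (volume.restrict (Ioi 0)) ≤ ENNReal.ofReal (D * ‖y₀‖)

/-- The system `y' = A y + B u` is completely stabilizable: every decay rate `α > 0` is achieved by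
some feedback law. -/
def CompletelyStabilizable (A : X →ₗ.[ℝ] X) (B : U →L[ℝ] ExtrapolationSpace A) : Prop :=
  ∀ α : ℝ, 0 < α → ∃ (K : X →ₗ.[ℝ] U) (S : ℝ → X →L[ℝ] X), IsStabilizingFeedback A B α K S

end Abstract

/-! ### The operator `A y = y'' + c y` with Dirichlet boundary conditions on `(0, 1)` -/

namespace PointHeat

/-- Lebesgue measure on `(0, 1)`. -/
abbrev μ : Measure ℝ := volume.restrict (Ioo (0 : ℝ) 1)

/-- The state space `L²(0, 1)`. -/
abbrev State : Type := Lp ℝ 2 μ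

/-- Test functions on `(0, 1)`, the elements of `C_c^∞(0, 1)`. -/
structure IsTest (ψ : ℝ → ℝ) : Prop where
  smooth : ContDiff ℝ ∞ ψ
  compact : HasCompactSupport ψ
  supp : tsupport ψ ⊆ Ioo 0 1

/-- `g ∈ L²(0, 1)` is the weak derivative of `f ∈ L²(0, 1)`. -/
def HasWeakDeriv (f g : State) : Prop :=
  ∀ ψ : ℝ → ℝ, IsTest ψ → ∫ x, f x * deriv ψ x ∂μ = -∫ x, g x * ψ x ∂μ

/-- `v` is a representative of `f ∈ L²(0, 1)` that is continuous on `[0, 1]`. -/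
def IsContRep (f : State) (v : ℝ → ℝ) : Prop :=
  ContinuousOn v (Icc 0 1) ∧ f =ᵐ[μ] v

/-- The Dirichlet condition `f(0) = f(1) = 0`, for the continuous representative of `f`. -/
def VanishesAtEnds (f : State) : Prop :=
  ∃ v : ℝ → ℝ, IsContRep f v ∧ v 0 = 0 ∧ v 1 = 0

theorem memLp_of_continuousOn {ψ : ℝ → ℝ} (h : ContinuousOn ψ (Icc 0 1)) : MemLp ψ 2 μ := by
  obtain ⟨C, hC⟩ := isCompact_Icc.exists_bound_of_continuousOn h
  refine MemLp.of_bound ((h.mono Ioo_subset_Icc_self).aestronglyMeasurable measurableSet_Ioo) C ?_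
  filter_upwards [ae_restrict_mem measurableSet_Ioo] with x hx
  exact hC x (Ioo_subset_Icc_self hx)

theorem integrable_mul (f : State) {ψ : ℝ → ℝ} (h : ContinuousOn ψ (Icc 0 1)) :
    Integrable (fun x => f x * ψ x) μ :=
  (Lp.memLp f).integrable_mul (memLp_of_continuousOn h)

theorem IsTest.continuous_deriv {ψ : ℝ → ℝ} (h : IsTest ψ) : Continuous (deriv ψ) :=
  h.smooth.continuous_deriv (by simp)

theorem HasWeakDeriv.add {f₁ g₁ f₂ g₂ : State} (h₁ : HasWeakDeriv f₁ g₁)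
    (h₂ : HasWeakDeriv f₂ g₂) : HasWeakDeriv (f₁ + f₂) (g₁ + g₂) := by
  intro ψ hψ
  have e₁ : ∫ x, (f₁ + f₂ : State) x * deriv ψ x ∂μ
      = ∫ x, (f₁ x * deriv ψ x + f₂ x * deriv ψ x) ∂μ := by
    refine integral_congr_ae ?_
    filter_upwards [Lp.coeFn_add f₁ f₂] with x hx
    rw [hx, Pi.add_apply, add_mul]
  have e₂ : ∫ x, (g₁ + g₂ : State) x * ψ x ∂μ = ∫ x, (g₁ x * ψ x + g₂ x * ψ x) ∂μ := by
    refine integral_congr_ae ?_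
    filter_upwards [Lp.coeFn_add g₁ g₂] with x hx
    rw [hx, Pi.add_apply, add_mul]
  have c₁ := hψ.continuous_deriv.continuousOn (s := Icc 0 1)
  have c₂ := hψ.smooth.continuous.continuousOn (s := Icc 0 1)
  rw [e₁, e₂, integral_add (integrable_mul f₁ c₁) (integrable_mul f₂ c₁),
    integral_add (integrable_mul g₁ c₂) (integrable_mul g₂ c₂), h₁ ψ hψ, h₂ ψ hψ]
  ring

theorem HasWeakDeriv.smul {f g : State} (a : ℝ) (h : HasWeakDeriv f g) :
    HasWeakDeriv (a • f) (a • g) := by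
  intro ψ hψ
  have e₁ : ∫ x, (a • f : State) x * deriv ψ x ∂μ = ∫ x, a * (f x * deriv ψ x) ∂μ := by
    refine integral_congr_ae ?_
    filter_upwards [Lp.coeFn_smul a f] with x hx
    simp [hx, mul_assoc]
  have e₂ : ∫ x, (a • g : State) x * ψ x ∂μ = ∫ x, a * (g x * ψ x) ∂μ := by
    refine integral_congr_ae ?_
    filter_upwards [Lp.coeFn_smul a g] with x hx
    simp [hx, mul_assoc]
  rw [e₁, e₂, integral_const_mul, integral_const_mul, h ψ hψ]
  ring

theorem IsContRep.add {f₁ f₂ : State} {v₁ v₂ : ℝ → ℝ} (h₁ : IsContRep f₁ v₁)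
    (h₂ : IsContRep f₂ v₂) : IsContRep (f₁ + f₂) (fun x => v₁ x + v₂ x) := by
  refine ⟨h₁.1.add h₂.1, ?_⟩
  filter_upwards [Lp.coeFn_add f₁ f₂, h₁.2, h₂.2] with x hx h1 h2
  rw [hx, Pi.add_apply, h1, h2]

theorem IsContRep.smul {f : State} {v : ℝ → ℝ} (a : ℝ) (h : IsContRep f v) :
    IsContRep (a • f) (fun x => a * v x) := by
  refine ⟨continuousOn_const.mul h.1, ?_⟩
  filter_upwards [Lp.coeFn_smul a f, h.2] with x hx h1
  simp [hx, h1]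

theorem IsContRep.eqOn {f : State} {v w : ℝ → ℝ} (hv : IsContRep f v) (hw : IsContRep f w) :
    EqOn v w (Icc 0 1) := by
  have h : v =ᵐ[volume.restrict (Icc (0 : ℝ) 1)] w := by
    rw [← restrict_Ioo_eq_restrict_Icc]
    exact hv.2.symm.trans hw.2
  exact Measure.eqOn_Icc_of_ae_eq volume zero_ne_one h hv.1 hw.1

theorem isContRep_zero : IsContRep 0 (fun _ => 0) :=
  ⟨continuousOn_const, Lp.coeFn_zero ℝ 2 μ⟩

theorem hasWeakDeriv_zero : HasWeakDeriv 0 0 := by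
  intro ψ _
  have h : ∀ θ : ℝ → ℝ, ∫ x, (0 : State) x * θ x ∂μ = 0 := by
    intro θ
    refine integral_eq_zero_of_ae ?_
    filter_upwards [Lp.coeFn_zero ℝ 2 μ] with x hx
    rw [hx, Pi.zero_apply, zero_mul]
  rw [h, h, neg_zero]

/-- The graph of `A y = y'' + c y` with domain `H²(0, 1) ∩ H₀¹(0, 1)`, that is, the `y` with weak
derivatives `y'` and `y''` in `L²(0, 1)` and `y(0) = y(1) = 0`. -/
def heatGraph (c : ℝ) : Submodule ℝ (State × State) where
  carrier := {p | VanishesAtEnds p.1 ∧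
    ∃ g h : State, HasWeakDeriv p.1 g ∧ HasWeakDeriv g h ∧ p.2 = h + c • p.1}
  zero_mem' := ⟨⟨_, isContRep_zero, rfl, rfl⟩, 0, 0, hasWeakDeriv_zero, hasWeakDeriv_zero, by simp⟩
  add_mem' := by
    rintro p q ⟨⟨v, hv, hv0, hv1⟩, g, h, hg, hh, e⟩ ⟨⟨w, hw, hw0, hw1⟩, g', h', hg', hh', e'⟩
    refine ⟨⟨_, hv.add hw, by simp [hv0, hw0], by simp [hv1, hw1]⟩, g + g', h + h',
      hg.add hg', hh.add hh', ?_⟩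
    simp only [Prod.snd_add, Prod.fst_add, e, e', smul_add]
    abel
  smul_mem' := by
    rintro a p ⟨⟨v, hv, hv0, hv1⟩, g, h, hg, hh, e⟩
    refine ⟨⟨_, hv.smul a, by simp [hv0], by simp [hv1]⟩, a • g, a • h, hg.smul a, hh.smul a, ?_⟩
    simp only [Prod.smul_snd, Prod.smul_fst, e, smul_add, smul_comm a c]

/-- The operator `A y = y'' + c y` in `L²(0, 1)`, with domain `H²(0, 1) ∩ H₀¹(0, 1)`. -/
def heatOp (c : ℝ) : State →ₗ.[ℝ] State := (heatGraph c).toLinearPMap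

theorem eq_zero_of_test {f : State} (h : ∀ ψ : ℝ → ℝ, IsTest ψ → ∫ x, f x * ψ x ∂μ = 0) :
    f = 0 := by
  have hf : IntegrableOn (fun x => f x) (Ioo 0 1) volume := by
    have := integrable_mul f (ψ := fun _ => 1) continuousOn_const
    simp only [mul_one] at this
    exact this
  have key := isOpen_Ioo.ae_eq_zero_of_integral_contDiff_smul_eq_zero (μ := volume)
    hf.locallyIntegrableOn (fun ψ h1 h2 h3 => by
      rw [← h ψ ⟨h1, h2, h3⟩, ← setIntegral_eq_integral_of_forall_compl_eq_zero (s := Ioo 0 1)]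
      · simp [mul_comm]
      · intro x hx
        rw [image_eq_zero_of_notMem_tsupport (fun hx' => hx (h3 hx')), zero_smul])
  rw [Lp.eq_zero_iff_ae_eq_zero]
  exact (ae_restrict_iff' measurableSet_Ioo).2 key

theorem HasWeakDeriv.eq_zero {h : State} (H : HasWeakDeriv 0 h) : h = 0 := by
  refine eq_zero_of_test fun ψ hψ => ?_
  have e : ∫ x, (0 : State) x * deriv ψ x ∂μ = 0 := by
    refine integral_eq_zero_of_ae ?_
    filter_upwards [Lp.coeFn_zero ℝ 2 μ] with x hx
    rw [hx, Pi.zero_apply, zero_mul]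
  have := H ψ hψ
  rw [e] at this
  linarith

/-- Weak second derivatives are unique, so `heatGraph c` is the graph of `heatOp c`. -/
theorem heatOp_graph (c : ℝ) : (heatOp c).graph = heatGraph c := by
  refine Submodule.toLinearPMap_graph_eq _ ?_
  rintro ⟨x, z⟩ ⟨-, g, h, hg, hh, e⟩ hx
  simp only at hx hg e
  subst hx
  obtain rfl := hg.eq_zero
  obtain rfl := hh.eq_zero
  simpa using e

/-- The class in `L²(0, 1)` of a function continuous on `[0, 1]`. -/
def mk (v : ℝ → ℝ) (h : ContinuousOn v (Icc 0 1)) : State := (memLp_of_continuousOn h).toLp v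

theorem isContRep_mk {v : ℝ → ℝ} (h : ContinuousOn v (Icc 0 1)) : IsContRep (mk v h) v :=
  ⟨h, MemLp.coeFn_toLp _⟩

theorem integral_mk_mul {v : ℝ → ℝ} (h : ContinuousOn v (Icc 0 1)) (θ : ℝ → ℝ) :
    ∫ x, mk v h x * θ x ∂μ = ∫ x in (0 : ℝ)..1, v x * θ x := by
  rw [intervalIntegral.integral_of_le zero_le_one, integral_Ioc_eq_integral_Ioo]
  refine integral_congr_ae ?_
  filter_upwards [(isContRep_mk h).2] with x hx
  rw [hx]

theorem hasWeakDeriv_mk {v w : ℝ → ℝ} (hv : ContinuousOn v (Icc 0 1))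
    (hw : ContinuousOn w (Icc 0 1)) (h : ∀ x, HasDerivAt v (w x) x) :
    HasWeakDeriv (mk v hv) (mk w hw) := by
  intro ψ hψ
  rw [integral_mk_mul, integral_mk_mul]
  have h0 : ψ 0 = 0 := image_eq_zero_of_notMem_tsupport fun h => by simpa using hψ.supp h
  have h1 : ψ 1 = 0 := image_eq_zero_of_notMem_tsupport fun h => by simpa using hψ.supp h
  rw [intervalIntegral.integral_mul_deriv_eq_deriv_mul (u := v) (v := ψ) (u' := w)
    (v' := deriv ψ) (fun x _ => h x)
    (fun x _ => (hψ.smooth.differentiable (by simp) x).hasDerivAt)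
    (ContinuousOn.intervalIntegrable (by simpa using hw))
    (hψ.continuous_deriv.intervalIntegrable _ _), h0, h1]
  simp

/-- Classical `C²` functions vanishing at both ends are in the domain of `heatOp c`. -/
theorem mem_heatOp_graph {y y' f : ℝ → ℝ} (hy : ContinuousOn y (Icc 0 1))
    (hy' : ContinuousOn y' (Icc 0 1)) (hf : ContinuousOn f (Icc 0 1))
    (h₁ : ∀ x, HasDerivAt y (y' x) x) (h₂ : ∀ x, HasDerivAt y' (f x) x)
    (h0 : y 0 = 0) (h1 : y 1 = 0) (c : ℝ) :
    (mk y hy, mk f hf + c • mk y hy) ∈ (heatOp c).graph := by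
  rw [heatOp_graph]
  exact ⟨⟨y, isContRep_mk hy, h0, h1⟩, mk y' hy', mk f hf, hasWeakDeriv_mk hy hy' h₁,
    hasWeakDeriv_mk hy' hf h₂, rfl⟩

theorem inner_mk (f : State) {v : ℝ → ℝ} (hv : ContinuousOn v (Icc 0 1)) :
    inner ℝ f (mk v hv) = ∫ x, f x * v x ∂μ := by
  rw [L2.inner_def]
  refine integral_congr_ae ?_
  filter_upwards [(isContRep_mk hv).2] with x hx
  rw [hx]
  simp [mul_comm]

theorem dense_heatOp_domain (c : ℝ) : Dense ((heatOp c).domain : Set State) := by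
  rw [Submodule.dense_iff_topologicalClosure_eq_top, Submodule.topologicalClosure_eq_top_iff,
    Submodule.eq_bot_iff]
  intro f hf
  refine eq_zero_of_test fun ψ hψ => ?_
  have d1 : ContDiff ℝ ∞ (deriv ψ) := hψ.smooth.deriv'
  have hm := mem_heatOp_graph (hψ.smooth.continuous.continuousOn (s := Icc 0 1))
    (d1.continuous.continuousOn (s := Icc 0 1))
    ((d1.continuous_deriv (by simp)).continuousOn (s := Icc 0 1))
    (fun x => (hψ.smooth.differentiable (by simp) x).hasDerivAt)
    (fun x => (d1.differentiable (by simp) x).hasDerivAt)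
    (image_eq_zero_of_notMem_tsupport fun h => by simpa using hψ.supp h)
    (image_eq_zero_of_notMem_tsupport fun h => by simpa using hψ.supp h) c
  rw [← inner_mk f hψ.smooth.continuous.continuousOn]
  exact Submodule.inner_left_of_mem_orthogonal (LinearPMap.mem_domain_of_mem_graph hm) hf

/-- The Green function of `y'' = f`, `y(0) = y(1) = 0`. -/
def green (x s : ℝ) : ℝ := -(min x s * (1 - max x s))

theorem continuous_green : Continuous fun p : ℝ × ℝ => green p.1 p.2 := by
  unfold green
  fun_prop

theorem abs_green_le {x s : ℝ} (hx : x ∈ Icc (0 : ℝ) 1) (hs : s ∈ Icc (0 : ℝ) 1) :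
    |green x s| ≤ 1 := by
  have h1 : 0 ≤ min x s := le_min hx.1 hs.1
  have h2 : min x s ≤ 1 := (min_le_left _ _).trans hx.2
  have h3 : 0 ≤ max x s := hx.1.trans (le_max_left _ _)
  have h4 : max x s ≤ 1 := max_le hx.2 hs.2
  unfold green
  rw [abs_neg, abs_of_nonneg (mul_nonneg h1 (by linarith))]
  nlinarith

/-- The solution operator of the Dirichlet problem. -/
def greenOp (h : ℝ → ℝ) (x : ℝ) : ℝ := ∫ s, green x s * h s ∂μ

theorem greenOp_continuousOn (h : State) : ContinuousOn (greenOp h) (Icc 0 1) := by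
  have hi : Integrable (fun x => h x) μ := by
    simpa using integrable_mul h (ψ := fun _ => 1) continuousOn_const
  refine continuousOn_of_dominated (bound := fun s => |h s|) (fun x _ => ?_) (fun x hx => ?_)
    hi.abs (Eventually.of_forall fun s => ?_)
  · exact ((continuous_green.comp (by fun_prop : Continuous fun s : ℝ => (x, s))
      ).aestronglyMeasurable).mul hi.aestronglyMeasurable
  · filter_upwards [ae_restrict_mem measurableSet_Ioo] with s hs
    rw [norm_mul]
    exact mul_le_of_le_one_left (norm_nonneg _) (abs_green_le hx (Ioo_subset_Icc_self hs))
  · exact ((continuous_green.comp (by fun_prop : Continuous fun x : ℝ => (x, s))).mul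
      continuous_const).continuousOn

theorem abs_greenOp_le (h : State) {x : ℝ} (hx : x ∈ Icc (0 : ℝ) 1) : |greenOp h x| ≤ ‖h‖ := by
  have hc : ContinuousOn (green x) (Icc 0 1) :=
    (continuous_green.comp (by fun_prop : Continuous fun s : ℝ => (x, s))).continuousOn
  have e : greenOp h x = inner ℝ h (mk (green x) hc) := by
    rw [inner_mk]
    simp [greenOp, mul_comm]
  rw [e]
  refine (abs_real_inner_le_norm _ _).trans (mul_le_of_le_one_right (norm_nonneg _) ?_)
  have := Lp.norm_le_of_ae_bound (f := mk (green x) hc) (C := 1) zero_le_one (by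
    filter_upwards [(isContRep_mk hc).2, ae_restrict_mem measurableSet_Ioo] with s hs hs'
    rw [hs]
    exact abs_green_le hx (Ioo_subset_Icc_self hs'))
  simpa [measureUnivNNReal] using this

theorem exists_solution {f : ℝ → ℝ} (hf : Continuous f) :
    ∃ y y' : ℝ → ℝ, (∀ x, HasDerivAt y (y' x) x) ∧ (∀ x, HasDerivAt y' (f x) x) ∧
      y 0 = 0 ∧ y 1 = 0 ∧ EqOn y (greenOp f) (Icc 0 1) := by
  have cP : Continuous fun s : ℝ => s * f s := by fun_prop
  have cQ : Continuous fun s : ℝ => (1 - s) * f s := by fun_prop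
  set P : ℝ → ℝ := fun x => ∫ s in (0 : ℝ)..x, s * f s with hP
  set Q : ℝ → ℝ := fun x => ∫ s in x..(1 : ℝ), (1 - s) * f s with hQ
  have dP : ∀ x, HasDerivAt P (x * f x) x := fun x => cP.integral_hasStrictDerivAt 0 x |>.hasDerivAt
  have dQ : ∀ x, HasDerivAt Q (-((1 - x) * f x)) x := fun x =>
    intervalIntegral.integral_hasDerivAt_left (cQ.intervalIntegrable _ _)
      (cQ.stronglyMeasurableAtFilter _ _) cQ.continuousAt
  refine ⟨fun x => -((1 - x) * P x) - x * Q x, fun x => P x - Q x, fun x => ?_, fun x => ?_,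
    by simp [hP], by simp [hQ], fun x hx => ?_⟩
  · refine (((((hasDerivAt_id x).const_sub 1).mul (dP x)).neg).sub
      ((hasDerivAt_id x).mul (dQ x))).congr_deriv ?_
    simp only [id]
    ring
  · refine ((dP x).sub (dQ x)).congr_deriv ?_
    ring
  · have cG : Continuous fun s : ℝ => green x s * f s :=
      (continuous_green.comp (by fun_prop : Continuous fun s : ℝ => (x, s))).mul hf
    have e : greenOp f x = ∫ s in (0 : ℝ)..1, green x s * f s := by
      rw [intervalIntegral.integral_of_le zero_le_one, integral_Ioc_eq_integral_Ioo]
      rfl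
    rw [e, ← intervalIntegral.integral_add_adjacent_intervals (cG.intervalIntegrable 0 x)
      (cG.intervalIntegrable x 1)]
    have e1 : ∫ s in (0 : ℝ)..x, green x s * f s = ∫ s in (0 : ℝ)..x, -(1 - x) * (s * f s) := by
      refine intervalIntegral.integral_congr fun s hs => ?_
      rw [uIcc_of_le hx.1] at hs
      simp only [green, min_eq_right hs.2, max_eq_left hs.2]
      ring
    have e2 : ∫ s in x..(1 : ℝ), green x s * f s = ∫ s in x..(1 : ℝ), -x * ((1 - s) * f s) := by
      refine intervalIntegral.integral_congr fun s hs => ?_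
      rw [uIcc_of_le hx.2] at hs
      simp only [green, min_eq_left hs.1, max_eq_right hs.1]
      ring
    rw [e1, e2, intervalIntegral.integral_const_mul, intervalIntegral.integral_const_mul]
    ring

theorem green_comm (x s : ℝ) : green x s = green s x := by
  simp [green, min_comm, max_comm]

theorem integral_mul_greenOp (h : State) {f : ℝ → ℝ} (hf : Continuous f) :
    ∫ x, h x * greenOp f x ∂μ = ∫ x, greenOp h x * f x ∂μ := by
  have hi : Integrable (fun x => h x) μ := by
    simpa using integrable_mul h (ψ := fun _ => 1) continuousOn_const
  have fi : Integrable f μ := (memLp_of_continuousOn hf.continuousOn).integrable (by norm_num)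
  have hint : Integrable (Function.uncurry fun x s : ℝ => green x s * (h x * f s)) (μ.prod μ) := by
    refine (hi.mul_prod fi).bdd_mul (c := 1) continuous_green.aestronglyMeasurable ?_
    have : ∀ᵐ p : ℝ × ℝ ∂(μ.prod μ), p ∈ Ioo (0 : ℝ) 1 ×ˢ Ioo (0 : ℝ) 1 := by
      rw [Measure.prod_restrict]
      exact ae_restrict_mem (measurableSet_Ioo.prod measurableSet_Ioo)
    filter_upwards [this] with p hp
    exact abs_green_le (Ioo_subset_Icc_self hp.1) (Ioo_subset_Icc_self hp.2)
  have e1 : ∀ x, h x * greenOp f x = ∫ s, green x s * (h x * f s) ∂μ := fun x => by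
    rw [greenOp, ← integral_const_mul]
    exact integral_congr_ae (Eventually.of_forall fun s => by ring)
  have e2 : ∀ s, greenOp h s * f s = ∫ x, green x s * (h x * f s) ∂μ := fun s => by
    rw [greenOp, ← integral_mul_const]
    exact integral_congr_ae (Eventually.of_forall fun x => by
      simp only [green_comm x s]
      ring)
  simp only [e1, e2]
  exact integral_integral_swap hint

/-- Elements of `D(A*)` have a continuous representative, bounded by the graph norm. -/
theorem exists_contRep {c : ℝ} {p : State × State} (hp : p ∈ (heatOp c).adjoint.graph) :
    ∃ v : ℝ → ℝ, IsContRep p.1 v ∧ ∀ x ∈ Icc (0 : ℝ) 1, |v x| ≤ (1 + |c|) * ‖p‖ := by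
  set h : State := p.2 - c • p.1 with hh
  have hG := greenOp_continuousOn h
  have key : p.1 = mk (greenOp h) hG := by
    rw [← sub_eq_zero]
    refine eq_zero_of_test fun ψ hψ => ?_
    have hc := hψ.smooth.continuous
    obtain ⟨y, y', d1, d2, y0, y1, hy⟩ := exists_solution hc
    have cy : Continuous y := continuous_iff_continuousAt.2 fun x => (d1 x).continuousAt
    have cy' : Continuous y' := continuous_iff_continuousAt.2 fun x => (d2 x).continuousAt
    have hm := mem_heatOp_graph cy.continuousOn cy'.continuousOn hc.continuousOn d1 d2 y0 y1 c
    obtain ⟨a, ha1, ha2⟩ := (LinearPMap.mem_graph_iff _).1 hp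
    obtain ⟨b, hb1, hb2⟩ := (LinearPMap.mem_graph_iff _).1 hm
    have hadj := LinearPMap.adjoint_isFormalAdjoint (dense_heatOp_domain c) a b
    rw [ha1, ha2, hb1, hb2, inner_add_right, inner_smul_right] at hadj
    have e3 : inner ℝ p.1 (mk ψ hc.continuousOn) = inner ℝ h (mk y cy.continuousOn) := by
      rw [hh, inner_sub_left, real_inner_smul_left, hadj]
      ring
    rw [← inner_mk _ hc.continuousOn, inner_sub_left, e3, inner_mk, real_inner_comm,
      real_inner_comm, inner_mk]
    have e4 : ∫ x, h x * y x ∂μ = ∫ x, h x * greenOp ψ x ∂μ := by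
      refine integral_congr_ae ?_
      filter_upwards [ae_restrict_mem measurableSet_Ioo] with x hx
      rw [hy (Ioo_subset_Icc_self hx)]
    have e5 : ∫ x, mk (greenOp h) hG x * ψ x ∂μ = ∫ x, greenOp h x * ψ x ∂μ := by
      refine integral_congr_ae ?_
      filter_upwards [(isContRep_mk hG).2] with x hx
      rw [hx]
    rw [e4, e5, integral_mul_greenOp h hc, sub_self]
  refine ⟨greenOp h, key ▸ isContRep_mk hG, fun x hx => (abs_greenOp_le h hx).trans ?_⟩
  calc ‖h‖ ≤ ‖p.2‖ + ‖c • p.1‖ := norm_sub_le _ _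
    _ = ‖p.2‖ + |c| * ‖p.1‖ := by rw [norm_smul, Real.norm_eq_abs]
    _ ≤ ‖p‖ + |c| * ‖p‖ := by
        gcongr
        · exact norm_snd_le p
        · exact norm_fst_le p
    _ = (1 + |c|) * ‖p‖ := by ring

/-- The Dirac mass `δ(· - x₀)` as an element of `X₋₁`: it sends `φ ∈ D(A*)` to the value at `x₀` of
the continuous representative of `φ`. -/
def dirac (c : ℝ) (x₀ : Ioo (0 : ℝ) 1) : ExtrapolationSpace (heatOp c) :=
  LinearMap.mkContinuous
    { toFun := fun φ => (exists_contRep φ.2).choose x₀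
      map_add' := fun φ φ' =>
        (exists_contRep (φ + φ').2).choose_spec.1.eqOn
          ((exists_contRep φ.2).choose_spec.1.add (exists_contRep φ'.2).choose_spec.1)
          (Ioo_subset_Icc_self x₀.2)
      map_smul' := fun a φ =>
        (exists_contRep (a • φ).2).choose_spec.1.eqOn
          ((exists_contRep φ.2).choose_spec.1.smul a) (Ioo_subset_Icc_self x₀.2) }
    (1 + |c|)
    (fun φ => (exists_contRep φ.2).choose_spec.2 x₀ (Ioo_subset_Icc_self x₀.2))

/-- The control operator `B u = δ(· - x₀) u`, from `U = ℝ` to `X₋₁`. -/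
def pointControl (c : ℝ) (x₀ : Ioo (0 : ℝ) 1) : ℝ →L[ℝ] ExtrapolationSpace (heatOp c) :=
  ContinuousLinearMap.toSpanSingleton ℝ (dirac c x₀)

end PointHeat

end

noncomputable section

namespace PointHeat

/-! ### Weak derivatives on `(0, 1)` -/

/-! The normalized sines $e_n$ are an orthonormal basis of $L^2(0,1)$ made of eigenvectors of $A$
and of $A^*$, with distinct eigenvalues $\lambda_n$. Put $\beta_n = e_n(x_0)$. Elements of $X_{-1}$
are determined by their values on the $e_n$ (`extrapolation_ext`), so $A_K x = z$ means $\lambda_n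
x_n + (Kx)\beta_n = z_n$ for all $n$ (`isClosedLoop_iff`). Some $\beta_n$ vanishes exactly when
$x_0$ is rational.

If $\beta_n = 0$, the feedback does not reach the $n$-th coordinate. A closed-loop semigroup with
rate $\alpha > -\lambda_n$ would make $\lambda_n - A_K$ surjective, by the Laplace transform
(`IsC0Semigroup.exists_resolvent`). The $n$-th coordinate of $(\lambda_n - A_K)x = e_n$ then reads
$0 = 1$ (`not_isStabilizingFeedback`).

If no $\beta_n$ vanishes, only the finitely many $\lambda_n > -\alpha$ have to be moved, and they
lie among $n < N$. Choose distinct $\mu_j \le -\alpha$ outside the spectrum, and let $w_j = \sum_n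
\beta_n(\lambda_n-\mu_j)^{-1} e_n$, so that $A w_j - \delta_{x_0} = \mu_j w_j$ in $X_{-1}$. Any $K$
with $K w_j = -1$ for $j < N$ and $K e_n = 0$ for $n \ge N$ has the eigenvectors $w_j$ and $e_n$ in
closed loop. The map $V$ replacing $e_j$ by $w_j$ for $j < N$ is an isomorphism, because its leading
block is a Cauchy matrix with rows scaled by $\beta_i \ne 0$ (`HilbertBasis.exists_modal_equiv`).
Hence $K$ exists and is bounded on all of $X$, and $V^{-1}A_KV$ is diagonal with spectrum below
$-\alpha$, domains included (`HilbertBasis.modal_iff`). The remaining conditions follow from the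
boundedness of $K$ and exponential decay. -/

theorem integrable_state (f : State) : Integrable (fun x => f x) μ := by
  simpa using integrable_mul f (ψ := fun _ => 1) continuousOn_const

theorem intervalIntegrable_state (f : State) : IntervalIntegrable (fun x => f x) volume 0 1 := by
  rw [intervalIntegrable_iff_integrableOn_Ioo_of_le zero_le_one]
  exact integrable_state f

theorem integral_eq_intervalIntegral (F : ℝ → ℝ) : ∫ x, F x ∂μ = ∫ x in (0 : ℝ)..1, F x := by
  rw [intervalIntegral.integral_of_le zero_le_one, integral_Ioc_eq_integral_Ioo]

theorem continuousOn_primitive (g : State) :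
    ContinuousOn (fun x => ∫ s in (0 : ℝ)..x, g s) (Icc 0 1) := by
  have := (intervalIntegrable_state g).absolutelyContinuousOnInterval_intervalIntegral
    (c := 0) (by simp)
  simpa using this.continuousOn

/-- Integration by parts for the primitive of an `L²` function. -/
theorem integral_primitive_mul_deriv (g : State) {ψ : ℝ → ℝ} (hψ : ContDiff ℝ 1 ψ) :
    ∫ x, (∫ s in (0 : ℝ)..x, g s) * deriv ψ x ∂μ
      = (∫ s in (0 : ℝ)..1, g s) * ψ 1 - ∫ x, g x * ψ x ∂μ := by
  have h1 := (intervalIntegrable_state g).absolutelyContinuousOnInterval_intervalIntegral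
    (c := 0) (by simp)
  have h2 : AbsolutelyContinuousOnInterval ψ 0 1 :=
    hψ.contDiffOn.absolutelyContinuousOnInterval
  rw [integral_eq_intervalIntegral, integral_eq_intervalIntegral,
    h1.integral_mul_deriv_eq_deriv_mul h2]
  simp only [intervalIntegral.integral_same, zero_mul, sub_zero]
  congr 1
  refine intervalIntegral.integral_congr_ae ?_
  filter_upwards [(intervalIntegrable_state g).ae_hasDerivAt_integral] with x hx hx'
  rw [(hx (uIoc_subset_uIcc hx') 0 (by simp)).deriv]

theorem IsTest.exists_Icc {ψ : ℝ → ℝ} (h : IsTest ψ) :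
    ∃ a b : ℝ, 0 < a ∧ b < 1 ∧ tsupport ψ ⊆ Icc a b := by
  rcases (tsupport ψ).eq_empty_or_nonempty with he | hne
  · exact ⟨1 / 2, 1 / 2, by norm_num, by norm_num, by simp [he]⟩
  · have hc : IsCompact (tsupport ψ) := h.compact
    obtain ⟨a, ha⟩ := hc.exists_isLeast hne
    obtain ⟨b, hb⟩ := hc.exists_isGreatest hne
    exact ⟨a, b, (h.supp ha.1).1, (h.supp hb.1).2, fun x hx => ⟨ha.2 hx, hb.2 hx⟩⟩

/-- A test function of mean zero is the derivative of a test function. -/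
theorem IsTest.exists_primitive {ψ : ℝ → ℝ} (h : IsTest ψ) (h0 : ∫ x, ψ x ∂μ = 0) :
    ∃ Ψ : ℝ → ℝ, IsTest Ψ ∧ deriv Ψ = ψ := by
  obtain ⟨a, b, ha, hb, hab⟩ := h.exists_Icc
  have hc := h.smooth.continuous
  set Ψ : ℝ → ℝ := fun x => ∫ s in (0 : ℝ)..x, ψ s with hΨ
  have hd : ∀ x, HasDerivAt Ψ (ψ x) x := fun x =>
    (hc.integral_hasStrictDerivAt 0 x).hasDerivAt
  have hderiv : deriv Ψ = ψ := funext fun x => (hd x).deriv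
  have hz : ∀ x ∉ Icc a b, ψ x = 0 := fun x hx =>
    image_eq_zero_of_notMem_tsupport fun hx' => hx (hab hx')
  have hsupp : Function.support Ψ ⊆ Icc a b := by
    intro x hx
    by_contra hx'
    apply hx
    rw [mem_Icc, not_and_or, not_le, not_le] at hx'
    rcases hx' with hx' | hx'
    · refine intervalIntegral.integral_zero_ae (Eventually.of_forall fun s hs => hz s ?_)
      intro hs'
      have : s ≤ max 0 x := hs.2
      have := hs'.1
      rcases max_cases 0 x with h | h <;> linarith
    · have e : ∫ s in (0 : ℝ)..1, ψ s = 0 := by rw [← integral_eq_intervalIntegral, h0]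
      have e' : ∫ s in x..(1 : ℝ), ψ s = 0 := by
        refine intervalIntegral.integral_zero_ae (Eventually.of_forall fun s hs => hz s ?_)
        intro hs'
        have : min x 1 < s := hs.1
        have := hs'.2
        rcases min_cases x 1 with h | h <;> linarith
      have := intervalIntegral.integral_add_adjacent_intervals (hc.intervalIntegrable 0 x)
        (hc.intervalIntegrable (μ := volume) x 1)
      rw [e, e', add_zero] at this
      exact this
  have hts : tsupport Ψ ⊆ Icc a b := closure_minimal hsupp isClosed_Icc
  refine ⟨Ψ, ⟨?_, isCompact_Icc.of_isClosed_subset (isClosed_tsupport _) hts, fun x hx =>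
    ⟨ha.trans_le (hts hx).1, (hts hx).2.trans_lt hb⟩⟩, hderiv⟩
  rw [contDiff_infty_iff_deriv, hderiv]
  exact ⟨fun x => (hd x).differentiableAt, h.smooth⟩

theorem exists_test_integral_one : ∃ η : ℝ → ℝ, IsTest η ∧ ∫ x, η x ∂μ = 1 := by
  let f : ContDiffBump (1 / 2 : ℝ) := ⟨1 / 8, 1 / 4, by norm_num, by norm_num⟩
  have hts : tsupport (f.normed volume) ⊆ Ioo 0 1 := by
    rw [f.tsupport_normed_eq, Real.closedBall_eq_Icc]
    intro x hx
    simp only [f, mem_Icc] at hx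
    constructor <;> linarith [hx.1, hx.2]
  refine ⟨f.normed volume, ⟨f.contDiff_normed, f.hasCompactSupport_normed, hts⟩, ?_⟩
  refine Eq.trans ?_ (f.integral_normed (μ := volume))
  exact setIntegral_eq_integral_of_forall_compl_eq_zero fun x hx =>
    image_eq_zero_of_notMem_tsupport fun hx' => hx (hts hx')

theorem IsTest.sub_smul {ψ η : ℝ → ℝ} (hψ : IsTest ψ) (hη : IsTest η) (a : ℝ) :
    IsTest (fun x => ψ x - a * η x) := by
  have hs : tsupport (fun x => ψ x - a * η x) ⊆ tsupport ψ ∪ tsupport η := by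
    refine closure_minimal (fun x hx => ?_) ((isClosed_tsupport _).union (isClosed_tsupport _))
    by_contra hx'
    rw [mem_union, not_or] at hx'
    apply hx
    simp [image_eq_zero_of_notMem_tsupport hx'.1, image_eq_zero_of_notMem_tsupport hx'.2]
  exact ⟨hψ.smooth.sub (contDiff_const.mul hη.smooth),
    (hψ.compact.isCompact.union hη.compact.isCompact).of_isClosed_subset (isClosed_tsupport _) hs,
    hs.trans (union_subset hψ.supp hη.supp)⟩

/-- The du Bois-Reymond lemma. -/
theorem ae_eq_const_of_test {f : State}
    (h : ∀ ψ : ℝ → ℝ, IsTest ψ → ∫ x, f x * deriv ψ x ∂μ = 0) :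
    ∃ a : ℝ, f =ᵐ[μ] fun _ => a := by
  obtain ⟨η, hη, hη1⟩ := exists_test_integral_one
  have ci : ∀ ψ : ℝ → ℝ, IsTest ψ → ContinuousOn ψ (Icc 0 1) := fun ψ hψ =>
    hψ.smooth.continuous.continuousOn
  have ti : ∀ ψ : ℝ → ℝ, IsTest ψ → Integrable ψ μ := fun ψ hψ =>
    (memLp_of_continuousOn (ci ψ hψ)).integrable (by norm_num)
  set a : ℝ := ∫ x, f x * η x ∂μ with ha
  have hcst : ContinuousOn (fun _ : ℝ => a) (Icc 0 1) := continuousOn_const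
  refine ⟨a, ?_⟩
  have : f - mk (fun _ => a) hcst = 0 := by
    refine eq_zero_of_test fun ψ hψ => ?_
    have e1 : ∫ x, (f - mk (fun _ => a) hcst : State) x * ψ x ∂μ
        = ∫ x, f x * ψ x ∂μ - a * ∫ x, ψ x ∂μ := by
      rw [← integral_const_mul, ← integral_sub (integrable_mul f (ci ψ hψ)) ((ti ψ hψ).const_mul a)]
      refine integral_congr_ae ?_
      filter_upwards [Lp.coeFn_sub f (mk (fun _ => a) hcst), (isContRep_mk hcst).2] with x h1 h2
      rw [h1, Pi.sub_apply, h2, sub_mul]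
    set m : ℝ := ∫ x, ψ x ∂μ with hm
    -- Subtracting $m\eta$ makes the mean zero, so the difference is the derivative of a test
    -- function and the hypothesis applies to it.
    have hθ := hψ.sub_smul hη m
    obtain ⟨Ψ, hΨ, hd⟩ := hθ.exists_primitive (by
      rw [integral_sub (ti ψ hψ) ((ti η hη).const_mul m), integral_const_mul, hη1, ← hm]
      ring)
    have := h Ψ hΨ
    rw [hd] at this
    have e2 : ∫ x, f x * (ψ x - m * η x) ∂μ = ∫ x, f x * ψ x ∂μ - m * a := by
      rw [ha, ← integral_const_mul, ← integral_sub (integrable_mul f (ci ψ hψ))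
        ((integrable_mul f (ci η hη)).const_mul m)]
      exact integral_congr_ae (Eventually.of_forall fun x => by ring)
    rw [e1, mul_comm a, ← e2, this]
  rw [sub_eq_zero.1 this]
  exact (isContRep_mk hcst).2

/-- The difference between $f$ and the primitive of $g$ has weak derivative zero, so it is constant
by du Bois-Reymond. -/
theorem HasWeakDeriv.exists_ae_eq {f g : State} (h : HasWeakDeriv f g) :
    ∃ a : ℝ, f =ᵐ[μ] fun x => a + ∫ s in (0 : ℝ)..x, g s := by
  have hG := continuousOn_primitive g
  have hae : ∀ᵐ x ∂μ, (f - mk _ hG : State) x = f x - ∫ s in (0 : ℝ)..x, g s := by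
    filter_upwards [Lp.coeFn_sub f (mk _ hG), (isContRep_mk hG).2] with x h1 h2
    rw [h1, Pi.sub_apply, h2]
  obtain ⟨a, ha⟩ := ae_eq_const_of_test (f := f - mk _ hG) (by
    intro ψ hψ
    have hc : ContinuousOn (deriv ψ) (Icc 0 1) := hψ.continuous_deriv.continuousOn
    have h1 : ψ 1 = 0 := image_eq_zero_of_notMem_tsupport fun h => by simpa using hψ.supp h
    have e : ∫ x, (f - mk _ hG : State) x * deriv ψ x ∂μ
        = ∫ x, f x * deriv ψ x ∂μ - ∫ x, (∫ s in (0 : ℝ)..x, g s) * deriv ψ x ∂μ := by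
      rw [← integral_sub (integrable_mul f hc)
        ((memLp_of_continuousOn (hG.fun_mul hc)).integrable (by norm_num))]
      refine integral_congr_ae ?_
      filter_upwards [hae] with x hx
      rw [hx, sub_mul]
    rw [e, h ψ hψ, integral_primitive_mul_deriv g (hψ.smooth.of_le (by simp)), h1]
    ring)
  refine ⟨a, ?_⟩
  filter_upwards [hae, ha] with x h1 h2
  rw [h1] at h2
  linarith

/-- Integration by parts against functions that need not vanish at the ends. -/
theorem integral_mul_deriv_of_ae_eq {f g : State} {a : ℝ}
    (h : f =ᵐ[μ] fun x => a + ∫ s in (0 : ℝ)..x, g s) {ψ : ℝ → ℝ} (hψ : ContDiff ℝ 1 ψ) :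
    ∫ x, f x * deriv ψ x ∂μ
      = (a + ∫ s in (0 : ℝ)..1, g s) * ψ 1 - a * ψ 0 - ∫ x, g x * ψ x ∂μ := by
  have hd : Continuous (deriv ψ) := hψ.continuous_deriv le_rfl
  have hG := continuousOn_primitive g
  have e : ∫ x, f x * deriv ψ x ∂μ
      = a * (∫ x, deriv ψ x ∂μ) + ∫ x, (∫ s in (0 : ℝ)..x, g s) * deriv ψ x ∂μ := by
    rw [← integral_const_mul, ← integral_add
      (((memLp_of_continuousOn hd.continuousOn).integrable (by norm_num)).const_mul a)
      ((memLp_of_continuousOn (hG.fun_mul hd.continuousOn)).integrable (by norm_num))]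
    refine integral_congr_ae ?_
    filter_upwards [h] with x hx
    rw [hx, add_mul]
  have e2 : ∫ x, deriv ψ x ∂μ = ψ 1 - ψ 0 := by
    rw [integral_eq_intervalIntegral]
    exact intervalIntegral.integral_deriv_eq_sub
      (fun x _ => hψ.differentiable (by simp) x) (hd.intervalIntegrable _ _)
  rw [e, e2, integral_primitive_mul_deriv g hψ]
  ring

/-- Green's formula for `y ∈ H²(0, 1) ∩ H₀¹(0, 1)`. -/
theorem integral_weakDeriv_weakDeriv_mul {y g h : State} (hy : VanishesAtEnds y)
    (hg : HasWeakDeriv y g) (hh : HasWeakDeriv g h) {ψ : ℝ → ℝ} (hψ : ContDiff ℝ 2 ψ)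
    (h0 : ψ 0 = 0) (h1 : ψ 1 = 0) :
    ∫ x, h x * ψ x ∂μ = ∫ x, y x * deriv (deriv ψ) x ∂μ := by
  obtain ⟨v, hv, hv0, hv1⟩ := hy
  obtain ⟨a, ha⟩ := hg.exists_ae_eq
  obtain ⟨b, hb⟩ := hh.exists_ae_eq
  have hrep : IsContRep y (fun x => a + ∫ s in (0 : ℝ)..x, g s) :=
    ⟨continuousOn_const.add (continuousOn_primitive g), ha⟩
  -- Continuous representatives agree up to the ends, so the Dirichlet condition gives $a = 0$ and
  -- $a + \int_0^1 g = 0$. These are the boundary terms of the first integration by parts; those of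
  -- the second vanish with $\psi$.
  have ea := hv.eqOn hrep (left_mem_Icc.2 zero_le_one)
  have eb := hv.eqOn hrep (right_mem_Icc.2 zero_le_one)
  simp only [intervalIntegral.integral_same, add_zero, hv0, hv1] at ea eb
  have hd : ContDiff ℝ 1 (deriv ψ) :=
    (contDiff_succ_iff_deriv (n := 1) |>.1 (by simpa [one_add_one_eq_two] using hψ)).2.2
  rw [integral_mul_deriv_of_ae_eq ha hd, ← eb, ← ea,
    integral_mul_deriv_of_ae_eq hb (hψ.of_le (by norm_num)), h0, h1]
  ring

end PointHeat

namespace PointHeat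

/-! ### The eigenfunctions of the Dirichlet Laplacian on `(0, 1)` -/

/-- The `n`-th normalized Dirichlet eigenfunction, as a function on `ℝ`. -/
def sine (n : ℕ) (x : ℝ) : ℝ := √2 * Real.sin ((n + 1) * Real.pi * x)

/-- The `n`-th eigenvalue of `heatOp c`. -/
def eigenvalue (c : ℝ) (n : ℕ) : ℝ := c - ((n + 1) * Real.pi) ^ 2

theorem contDiff_sine (n : ℕ) {k : ℕ∞ω} : ContDiff ℝ k (sine n) := by
  unfold sine
  fun_prop

theorem continuousOn_sine (n : ℕ) : ContinuousOn (sine n) (Icc 0 1) :=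
  (contDiff_sine n (k := 0)).continuous.continuousOn

theorem sine_zero (n : ℕ) : sine n 0 = 0 := by simp [sine]

theorem sine_one (n : ℕ) : sine n 1 = 0 := by
  have := Real.sin_nat_mul_pi (n + 1)
  push_cast at this
  simp [sine, this]

theorem hasDerivAt_sine (n : ℕ) (x : ℝ) :
    HasDerivAt (sine n) (√2 * (((n + 1) * Real.pi) * Real.cos ((n + 1) * Real.pi * x))) x := by
  have h : HasDerivAt (fun x : ℝ => (n + 1) * Real.pi * x) ((n + 1) * Real.pi) x := by
    simpa using (hasDerivAt_id x).const_mul ((n + 1) * Real.pi)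
  exact (h.sin.const_mul (√2)).congr_deriv (by ring)

theorem hasDerivAt_deriv_sine (n : ℕ) (x : ℝ) :
    HasDerivAt (fun x => √2 * (((n + 1) * Real.pi) * Real.cos ((n + 1) * Real.pi * x)))
      (-((n + 1) * Real.pi) ^ 2 * sine n x) x := by
  have h : HasDerivAt (fun x : ℝ => (n + 1) * Real.pi * x) ((n + 1) * Real.pi) x := by
    simpa using (hasDerivAt_id x).const_mul ((n + 1) * Real.pi)
  exact ((h.cos.const_mul _).const_mul (√2)).congr_deriv (by rw [sine]; ring)

theorem deriv_deriv_sine (n : ℕ) :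
    deriv (deriv (sine n)) = fun x => -((n + 1) * Real.pi) ^ 2 * sine n x := by
  have : deriv (sine n) = fun x => √2 * (((n + 1) * Real.pi) * Real.cos ((n + 1) * Real.pi * x)) :=
    funext fun x => (hasDerivAt_sine n x).deriv
  rw [this]
  exact funext fun x => (hasDerivAt_deriv_sine n x).deriv

/-- The `n`-th normalized Dirichlet eigenfunction in `L²(0, 1)`. -/
def mode (n : ℕ) : State := mk (sine n) (continuousOn_sine n)

theorem inner_mode (n : ℕ) (f : State) : inner ℝ (mode n) f = ∫ x, f x * sine n x ∂μ := by
  rw [real_inner_comm, mode, inner_mk]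

theorem mode_mem_graph (c : ℝ) (n : ℕ) :
    (mode n, eigenvalue c n • mode n) ∈ (heatOp c).graph := by
  have hf : ContinuousOn (fun x => -((n + 1) * Real.pi) ^ 2 * sine n x) (Icc 0 1) :=
    continuousOn_const.mul (continuousOn_sine n)
  have h := mem_heatOp_graph (continuousOn_sine n) (by fun_prop) hf (hasDerivAt_sine n)
    (hasDerivAt_deriv_sine n) (sine_zero n) (sine_one n) c
  have e : mk _ hf = (-((n + 1) * Real.pi) ^ 2) • mode n := by
    refine Lp.ext ?_
    filter_upwards [(isContRep_mk hf).2, ((isContRep_mk (continuousOn_sine n)).smul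
      (-((n + 1) * Real.pi) ^ 2)).2] with x h1 h2
    rw [h1]
    exact h2.symm
  rw [e] at h
  rw [eigenvalue, sub_eq_neg_add, add_smul]
  exact h

/-- Green's formula moves both derivatives onto the sine. -/
theorem inner_mode_of_mem_graph {c : ℝ} {p : State × State} (hp : p ∈ (heatOp c).graph) (n : ℕ) :
    inner ℝ (mode n) p.2 = eigenvalue c n * inner ℝ (mode n) p.1 := by
  rw [heatOp_graph] at hp
  obtain ⟨hv, g, h, hg, hh, e⟩ := hp
  rw [e, inner_add_right, real_inner_smul_right, inner_mode n h,
    integral_weakDeriv_weakDeriv_mul hv hg hh (contDiff_sine n) (sine_zero n) (sine_one n),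
    inner_mode, deriv_deriv_sine, eigenvalue, sub_mul, add_comm, sub_eq_add_neg,
    ← neg_mul]
  congr 1
  rw [← integral_const_mul]
  exact integral_congr_ae (Eventually.of_forall fun x => by simp only []; ring)

theorem mode_mem_adjoint_graph (c : ℝ) (n : ℕ) :
    (mode n, eigenvalue c n • mode n) ∈ (heatOp c).adjoint.graph := by
  have key : ∀ x : (heatOp c).domain,
      inner ℝ (eigenvalue c n • mode n) (x : State) = inner ℝ (mode n) (heatOp c x) := by
    intro x
    rw [real_inner_smul_left]
    exact (inner_mode_of_mem_graph ((heatOp c).mem_graph x) n).symm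
  have hm : mode n ∈ (heatOp c).adjoint.domain :=
    LinearPMap.mem_adjoint_domain_of_exists _ ⟨_, key⟩
  exact (LinearPMap.mem_graph_iff _).2 ⟨⟨mode n, hm⟩, rfl,
    LinearPMap.adjoint_apply_eq (dense_heatOp_domain c) ⟨mode n, hm⟩ key⟩

/-- The eigenfunctions lie in $D(A)$, so the adjoint relation tested on them shows that $A^*$ acts
diagonally; self-adjointness of $A$ need not be proved. -/
theorem inner_mode_of_mem_adjoint_graph {c : ℝ} {p : State × State}
    (hp : p ∈ (heatOp c).adjoint.graph) (n : ℕ) :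
    inner ℝ (mode n) p.2 = eigenvalue c n * inner ℝ (mode n) p.1 := by
  obtain ⟨a, ha1, ha2⟩ := (LinearPMap.mem_graph_iff _).1 hp
  obtain ⟨b, hb1, hb2⟩ := (LinearPMap.mem_graph_iff _).1 (mode_mem_graph c n)
  have hadj := LinearPMap.adjoint_isFormalAdjoint (dense_heatOp_domain c) a b
  rw [ha1, ha2, hb1, hb2, real_inner_smul_right] at hadj
  rw [real_inner_comm, hadj, real_inner_comm]

theorem eigenvalue_strictAnti (c : ℝ) : StrictAnti (eigenvalue c) := by
  intro m n hmn
  have : (m : ℝ) < n := by exact_mod_cast hmn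
  have h0 : (0 : ℝ) ≤ m := by positivity
  have := Real.pi_pos
  unfold eigenvalue
  gcongr

theorem inner_mode_self (n : ℕ) : inner ℝ (mode n) (mode n) = (1 : ℝ) := by
  have hk : ((n : ℝ) + 1) * Real.pi ≠ 0 := by have := Real.pi_pos; positivity
  have hs := Real.sin_nat_mul_pi (n + 1)
  push_cast at hs
  rw [inner_mode, mode, integral_mk_mul]
  have e : ∀ x, sine n x * sine n x = 2 * Real.sin ((n + 1) * Real.pi * x) ^ 2 := fun x => by
    have := Real.mul_self_sqrt (show (0 : ℝ) ≤ 2 by norm_num)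
    rw [sine]
    linear_combination Real.sin ((n + 1) * Real.pi * x) ^ 2 * this
  simp only [e]
  rw [intervalIntegral.integral_const_mul,
    intervalIntegral.integral_comp_mul_left (fun x => Real.sin x ^ 2) hk, integral_sin_sq]
  simp [hs]
  field_simp

theorem orthonormal_mode : Orthonormal ℝ mode := by
  rw [orthonormal_iff_ite]
  intro m n
  split_ifs with h
  · rw [h, inner_mode_self]
  -- Eigenvectors of a symmetric operator for distinct eigenvalues are orthogonal. The shift is
  -- immaterial, so $c = 0$ is used.
  · have := inner_mode_of_mem_graph (mode_mem_graph 0 n) m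
    rw [real_inner_smul_right] at this
    exact (mul_eq_mul_right_iff.1 this).resolve_left
      fun h' => h ((eigenvalue_strictAnti 0).injective h').symm

/-- Induction on $k$ through $2\cos\theta\sin m\theta = \sin(m+1)\theta + \sin(m-1)\theta$, which
trades one cosine factor for two neighbouring frequencies. -/
theorem integral_mul_cos_pow_mul_sin {f : State} (h : ∀ n, inner ℝ (mode n) f = 0) (k n : ℕ) :
    ∫ x, f x * (Real.cos (Real.pi * x) ^ k * Real.sin (n * (Real.pi * x))) ∂μ = 0 := by
  induction k generalizing n with
  | zero =>
    rcases n with _ | n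
    · simp
    · have := h n
      rw [inner_mode] at this
      have e : ∀ x, f x * sine n x
          = √2 * (f x * (Real.cos (Real.pi * x) ^ 0 * Real.sin ((n + 1 : ℕ) * (Real.pi * x)))) := by
        intro x
        rw [sine]
        push_cast
        ring_nf
      simp only [e] at this
      rw [integral_const_mul] at this
      exact (mul_eq_zero.1 this).resolve_left (by positivity)
  | succ k ih =>
    have hi : ∀ m : ℕ, Integrable
        (fun x => f x * (Real.cos (Real.pi * x) ^ k * Real.sin (m * (Real.pi * x)))) μ := fun m =>
      integrable_mul f (by fun_prop)
    rcases n with _ | n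
    · simp
    · have e : ∀ x, f x * (Real.cos (Real.pi * x) ^ (k + 1) * Real.sin ((n + 1 : ℕ) * (Real.pi * x)))
          = 2⁻¹ * (f x * (Real.cos (Real.pi * x) ^ k * Real.sin ((n + 2 : ℕ) * (Real.pi * x)))
            + f x * (Real.cos (Real.pi * x) ^ k * Real.sin (n * (Real.pi * x)))) := by
        intro x
        have h1 : ((n + 2 : ℕ) : ℝ) * (Real.pi * x)
          = ((n + 1 : ℕ) : ℝ) * (Real.pi * x) + Real.pi * x := by push_cast; ring
        have h2 : (n : ℝ) * (Real.pi * x)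
          = ((n + 1 : ℕ) : ℝ) * (Real.pi * x) - Real.pi * x := by push_cast; ring
        rw [h1, h2, Real.sin_add, Real.sin_sub]
        ring
      simp only [e]
      rw [integral_const_mul, integral_add (hi _) (hi _), ih, ih]
      simp

theorem integral_mul_polynomial_cos_mul_sin {f : State} (h : ∀ n, inner ℝ (mode n) f = 0)
    (p : Polynomial ℝ) :
    ∫ x, f x * (p.eval (Real.cos (Real.pi * x)) * Real.sin (Real.pi * x)) ∂μ = 0 := by
  have e : ∀ x, f x * (p.eval (Real.cos (Real.pi * x)) * Real.sin (Real.pi * x))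
      = ∑ k ∈ p.support, p.coeff k *
        (f x * (Real.cos (Real.pi * x) ^ k * Real.sin ((1 : ℕ) * (Real.pi * x)))) := by
    intro x
    rw [Polynomial.eval_eq_sum, Polynomial.sum, Finset.sum_mul, Finset.mul_sum]
    refine Finset.sum_congr rfl fun k _ => ?_
    rw [Nat.cast_one, one_mul]
    ring
  simp only [e]
  rw [integral_finsetSum _ fun k _ => (integrable_mul f (by fun_prop)).const_mul _]
  refine Finset.sum_eq_zero fun k _ => ?_
  rw [integral_const_mul, integral_mul_cos_pow_mul_sin h, mul_zero]

/-- The sines are complete in `L²(0, 1)`. -/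
theorem eq_zero_of_inner_mode {f : State} (h : ∀ n, inner ℝ (mode n) f = 0) : f = 0 := by
  refine eq_zero_of_test fun ψ hψ => ?_
  have hpi := Real.pi_pos
  have hsin : ∀ x ∈ Ioo (0 : ℝ) 1, 0 < Real.sin (Real.pi * x) := fun x hx =>
    Real.sin_pos_of_pos_of_lt_pi (by have := hx.1; positivity) (by nlinarith [hx.2])
  -- The quotient is continuous because $\psi$ vanishes near the zeros $0$ and $1$ of the sine, and
  -- vanishes identically outside $(0,1)$.
  have hq : Continuous fun x => ψ x / Real.sin (Real.pi * x) := by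
    refine continuous_iff_continuousAt.2 fun x => ?_
    by_cases hx : x ∈ tsupport ψ
    · exact hψ.smooth.continuous.continuousAt.div (by fun_prop) (hsin x (hψ.supp hx)).ne'
    · have : (fun x => ψ x / Real.sin (Real.pi * x)) =ᶠ[𝓝 x] fun _ => 0 := by
        filter_upwards [notMem_tsupport_iff_eventuallyEq.1 hx] with y hy
        rw [hy]
        simp
      exact continuousAt_const.congr this.symm
  -- With $t = \cos \pi x$ the quotient becomes a continuous function on $[-1,1]$, to which
  -- Weierstrass approximation applies. Thus $\psi$ is uniformly close to $p(\cos\pi x)\sin\pi x$,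
  -- which is orthogonal to $f$.
  have hθ : Continuous fun t => ψ (Real.arccos t / Real.pi) /
      Real.sin (Real.pi * (Real.arccos t / Real.pi)) :=
    hq.comp (Real.continuous_arccos.div_const _)
  have hbound : ∀ ε > 0, |∫ x, f x * ψ x ∂μ| ≤ ε * ∫ x, |f x| ∂μ := by
    intro ε hε
    obtain ⟨p, hp⟩ := exists_polynomial_near_of_continuousOn (-1) 1 _ hθ.continuousOn ε hε
    have e : ∫ x, f x * ψ x ∂μ = ∫ x, f x *
        (ψ x - p.eval (Real.cos (Real.pi * x)) * Real.sin (Real.pi * x)) ∂μ := by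
      have := integral_sub (integrable_mul f (hψ.smooth.continuous.continuousOn))
        (integrable_mul f (ψ := fun x => p.eval (Real.cos (Real.pi * x)) * Real.sin (Real.pi * x))
          (by fun_prop))
      rw [integral_mul_polynomial_cos_mul_sin h, sub_zero] at this
      rw [← this]
      exact integral_congr_ae (Eventually.of_forall fun x => by ring)
    rw [e, ← Real.norm_eq_abs, ← integral_const_mul]
    refine norm_integral_le_of_norm_le ((integrable_state f).abs.const_mul ε) ?_
    filter_upwards [ae_restrict_mem measurableSet_Ioo] with x hx
    have hs := hsin x hx
    have hpx := hp (Real.cos (Real.pi * x)) ⟨Real.neg_one_le_cos _, Real.cos_le_one _⟩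
    rw [Real.arccos_cos (by have := hx.1; positivity) (by nlinarith [hx.2]),
      mul_div_cancel_left₀ _ hpi.ne'] at hpx
    have e2 : ψ x - p.eval (Real.cos (Real.pi * x)) * Real.sin (Real.pi * x)
        = -((p.eval (Real.cos (Real.pi * x)) - ψ x / Real.sin (Real.pi * x))
          * Real.sin (Real.pi * x)) := by
      field_simp
      ring
    rw [norm_mul, e2, norm_neg, norm_mul, mul_comm, Real.norm_eq_abs, Real.norm_eq_abs,
      Real.norm_eq_abs]
    refine mul_le_mul_of_nonneg_right ?_ (abs_nonneg _)
    exact (mul_le_of_le_one_right (abs_nonneg _) (Real.abs_sin_le_one _)).trans hpx.le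
  have hlim : Tendsto (fun ε : ℝ => ε * ∫ x, |f x| ∂μ) (𝓝[>] 0) (𝓝 0) := by
    have : Tendsto (fun ε : ℝ => ε * ∫ x, |f x| ∂μ) (𝓝 0) (𝓝 (0 * ∫ x, |f x| ∂μ)) :=
      tendsto_id.mul_const _
    rw [zero_mul] at this
    exact this.mono_left nhdsWithin_le_nhds
  exact abs_nonpos_iff.1 (ge_of_tendsto hlim (eventually_mem_nhdsWithin.mono hbound))

/-- The Dirichlet eigenfunctions as a Hilbert basis of `L²(0, 1)`. -/
def modeBasis : HilbertBasis ℕ ℝ State :=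
  HilbertBasis.mkOfOrthogonalEqBot orthonormal_mode <| by
    rw [Submodule.eq_bot_iff]
    intro f hf
    exact eq_zero_of_inner_mode fun n =>
      Submodule.inner_right_of_mem_orthogonal (Submodule.subset_span (mem_range_self n)) hf

theorem modeBasis_apply (n : ℕ) : modeBasis n = mode n := by
  simp [modeBasis]

/-- The pair `(φ, A* φ)` for the `n`-th eigenfunction `φ`. -/
def adjointMode (c : ℝ) (n : ℕ) : (heatOp c).adjoint.graph :=
  ⟨(mode n, eigenvalue c n • mode n), mode_mem_adjoint_graph c n⟩

theorem dirac_adjointMode (c : ℝ) (x₀ : Ioo (0 : ℝ) 1) (n : ℕ) :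
    dirac c x₀ (adjointMode c n) = sine n x₀ :=
  (exists_contRep (adjointMode c n).2).choose_spec.1.eqOn (isContRep_mk (continuousOn_sine n))
    (Ioo_subset_Icc_self x₀.2)

/-- The coefficients of $A^*\varphi$ are $\lambda_n$ times those of $\varphi$, so the two Fourier
series combine into one that converges in the graph norm. -/
theorem hasSum_adjointMode {c : ℝ} (φ : (heatOp c).adjoint.graph) :
    HasSum (fun n => (inner ℝ (mode n) (φ : State × State).1 : ℝ) • adjointMode c n) φ := by
  have h : HasSum (fun n => (inner ℝ (mode n) (φ : State × State).1 : ℝ) •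
      ((mode n, eigenvalue c n • mode n) : State × State)) (φ : State × State) := by
    have h1 := modeBasis.hasSum_repr (φ : State × State).1
    have h2 := modeBasis.hasSum_repr (φ : State × State).2
    simp only [HilbertBasis.repr_apply_apply, modeBasis_apply] at h1 h2
    convert! h1.prodMk h2 using 2 with n
    rw [inner_mode_of_mem_adjoint_graph φ.2, Prod.smul_mk, smul_smul, mul_comm]
  exact Topology.IsInducing.subtypeVal.hasSum_iff (g := (heatOp c).adjoint.graph.subtype) _ _ |>.1 h

/-- Elements of `X₋₁` are determined by their values on the eigenfunctions. -/
theorem extrapolation_ext {c : ℝ} {F G : ExtrapolationSpace (heatOp c)}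
    (h : ∀ n, F (adjointMode c n) = G (adjointMode c n)) : F = G := by
  ext φ
  have hF := (hasSum_adjointMode φ).mapL F
  have hG := (hasSum_adjointMode φ).mapL G
  simp only [map_smul, h] at hF hG
  exact hF.unique hG

/-- The closed-loop operator in terms of Fourier coefficients. -/
theorem isClosedLoop_iff {c : ℝ} {x₀ : Ioo (0 : ℝ) 1} {K : State →ₗ.[ℝ] ℝ} {x z : State} :
    IsClosedLoop (heatOp c) (pointControl c x₀) K x z ↔ ∃ hx : x ∈ K.domain,
      ∀ n, eigenvalue c n * inner ℝ (mode n) x + K ⟨x, hx⟩ * sine n x₀ = inner ℝ (mode n) z := by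
  refine exists_congr fun hx => ⟨fun h n => ?_, fun h φ => ?_⟩
  · have := h (adjointMode c n)
    simp only [pointControl, ContinuousLinearMap.toSpanSingleton_apply,
      _root_.smul_apply, dirac_adjointMode, smul_eq_mul] at this
    simp only [adjointMode, real_inner_smul_right] at this
    rw [real_inner_comm, this, real_inner_comm]
  -- Both sides are continuous functionals of $\varphi$ in the graph norm, so agreement on the
  -- eigenfunctions is enough.
  · let F : ExtrapolationSpace (heatOp c) :=
      ((innerSL ℝ x).comp (ContinuousLinearMap.snd ℝ State State)).comp
        (heatOp c).adjoint.graph.subtypeL + pointControl c x₀ (K ⟨x, hx⟩)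
    let G : ExtrapolationSpace (heatOp c) :=
      ((innerSL ℝ z).comp (ContinuousLinearMap.fst ℝ State State)).comp
        (heatOp c).adjoint.graph.subtypeL
    have hFG : F = G := extrapolation_ext fun n => by
      simp only [F, G, pointControl, ContinuousLinearMap.toSpanSingleton_apply,
        _root_.add_apply, _root_.smul_apply, dirac_adjointMode,
        smul_eq_mul, ContinuousLinearMap.comp_apply, Submodule.subtypeL_apply, innerSL_apply_apply]
      simp only [adjointMode, ContinuousLinearMap.coe_snd', ContinuousLinearMap.coe_fst',
        real_inner_smul_right]
      rw [real_inner_comm (mode n) x, h n, real_inner_comm]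
    exact congrArg (fun T : ExtrapolationSpace (heatOp c) => T φ) hFG

end PointHeat

/-! ### Diagonal semigroups -/

section Diagonal

variable {ι H : Type*} [NormedAddCommGroup H] [InnerProductSpace ℝ H]

theorem HilbertBasis.hasSum_sq_inner (b : HilbertBasis ι ℝ H) (x : H) :
    HasSum (fun i => (inner ℝ (b i) x) ^ 2) (‖x‖ ^ 2) := by
  have := b.hasSum_inner_mul_inner x x
  rw [real_inner_self_eq_norm_sq] at this
  refine this.congr_fun fun i => ?_
  rw [real_inner_comm, sq]

theorem HilbertBasis.ext_inner (b : HilbertBasis ι ℝ H) {x y : H}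
    (h : ∀ i, inner ℝ (b i) x = inner ℝ (b i) y) : x = y := by
  refine b.repr.injective (lp.ext (funext fun i => ?_))
  rw [b.repr_apply_apply, b.repr_apply_apply, h]

theorem HilbertBasis.exists_inner_eq (b : HilbertBasis ι ℝ H) {a : ι → ℝ}
    (ha : Summable fun i => a i ^ 2) : ∃ x : H, ∀ i, inner ℝ (b i) x = a i := by
  have hm : Memℓp a 2 := memℓp_gen (by simpa using ha)
  refine ⟨b.repr.symm ⟨a, hm⟩, fun i => ?_⟩
  rw [← b.repr_apply_apply, LinearIsometryEquiv.apply_symm_apply]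

theorem HilbertBasis.norm_le_of_inner (b : HilbertBasis ι ℝ H) {x y : H} {C : ℝ} (hC : 0 ≤ C)
    (h : ∀ i, |inner ℝ (b i) y| ≤ C * |inner ℝ (b i) x|) : ‖y‖ ≤ C * ‖x‖ := by
  refine le_of_sq_le_sq ?_ (by positivity)
  rw [mul_pow]
  refine hasSum_le (fun i => ?_) (b.hasSum_sq_inner y) ((b.hasSum_sq_inner x).mul_left (C ^ 2))
  rw [← mul_pow, ← sq_abs]
  refine (pow_le_pow_left₀ (abs_nonneg _) (h i) 2).trans_eq ?_
  rw [mul_pow, sq_abs, mul_pow]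

theorem HilbertBasis.exists_diagonal (b : HilbertBasis ι ℝ H) {m : ι → ℝ} {C : ℝ} (hC : 0 ≤ C)
    (hm : ∀ i, |m i| ≤ C) :
    ∃ T : H →L[ℝ] H, ‖T‖ ≤ C ∧ ∀ x i, inner ℝ (b i) (T x) = m i * inner ℝ (b i) x := by
  have key : ∀ x : H, ∃ y : H, ∀ i, inner ℝ (b i) y = m i * inner ℝ (b i) x := fun x => by
    refine b.exists_inner_eq (Summable.of_nonneg_of_le (fun i => sq_nonneg _) (fun i => ?_)
      ((b.hasSum_sq_inner x).summable.mul_left (C ^ 2)))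
    rw [mul_pow, ← sq_abs (m i)]
    gcongr
    exact hm i
  choose T hT using key
  let L : H →ₗ[ℝ] H :=
    { toFun := T
      map_add' := fun x y => b.ext_inner fun i => by
        simp only [inner_add_right, hT]
        ring
      map_smul' := fun a x => b.ext_inner fun i => by
        simp only [real_inner_smul_right, hT, RingHom.id_apply]
        ring }
  have hL : ∀ x, ‖L x‖ ≤ C * ‖x‖ := fun x => b.norm_le_of_inner hC fun i => by
    change |inner ℝ (b i) (T x)| ≤ _
    rw [hT, abs_mul]
    exact mul_le_mul_of_nonneg_right (hm i) (abs_nonneg _)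
  exact ⟨L.mkContinuous C hL, L.mkContinuous_norm_le hC hL, hT⟩

/-- Dominated convergence for the Parseval series: coefficientwise convergence suffices once the
coefficients are dominated by those of a fixed vector. -/
theorem HilbertBasis.tendsto_zero_of_inner (b : HilbertBasis ι ℝ H) {τ : Type*} {l : Filter τ}
    {d : τ → H} {C : ℝ} (z : H)
    (hd : ∀ i, Tendsto (fun t => inner ℝ (b i) (d t)) l (𝓝 0))
    (hb : ∀ᶠ t in l, ∀ i, |inner ℝ (b i) (d t)| ≤ C * |inner ℝ (b i) z|) :
    Tendsto d l (𝓝 0) := by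
  have h := tendsto_tsum_of_dominated_convergence (𝓕 := l)
    (f := fun t i => (inner ℝ (b i) (d t)) ^ 2) (g := fun _ => (0 : ℝ))
    (bound := fun i => C ^ 2 * (inner ℝ (b i) z) ^ 2)
    ((b.hasSum_sq_inner z).summable.mul_left _)
    (fun i => by simpa using (hd i).pow 2)
    (hb.mono fun t ht i => by
      rw [Real.norm_eq_abs, abs_pow, ← mul_pow, ← sq_abs (C * _)]
      refine pow_le_pow_left₀ (abs_nonneg _) ((ht i).trans ?_) 2
      rw [abs_mul]
      exact mul_le_mul_of_nonneg_right (le_abs_self C) (abs_nonneg _))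
  simp only [tsum_zero, (b.hasSum_sq_inner _).tsum_eq] at h
  rw [tendsto_zero_iff_norm_tendsto_zero]
  simpa using h.sqrt

theorem tendsto_inv_mul_exp_sub_one (r : ℝ) :
    Tendsto (fun t : ℝ => t⁻¹ * (Real.exp (r * t) - 1)) (𝓝[>] 0) (𝓝 r) := by
  have h : HasDerivAt (fun t : ℝ => Real.exp (r * t)) r 0 := by
    have h0 : HasDerivAt (fun t : ℝ => r * t) r 0 := by
      simpa using (hasDerivAt_id (0 : ℝ)).const_mul r
    simpa using h0.exp
  simpa using h.tendsto_slope_zero_right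

theorem abs_inv_mul_exp_sub_one_le {r t : ℝ} (hr : r ≤ 0) (ht : 0 < t) :
    |t⁻¹ * (Real.exp (r * t) - 1)| ≤ |r| := by
  have h1 : Real.exp (r * t) ≤ 1 := Real.exp_le_one_iff.2 (mul_nonpos_of_nonpos_of_nonneg hr ht.le)
  have h2 := Real.add_one_le_exp (r * t)
  rw [abs_mul, abs_of_pos (inv_pos.2 ht), abs_of_nonpos (by linarith), abs_of_nonpos hr,
    inv_mul_le_iff₀ ht]
  linarith

/-- The semigroup of the diagonal operator with spectrum `ν`, bounded above by `-α`. -/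
theorem HilbertBasis.exists_semigroup (b : HilbertBasis ι ℝ H) {ν : ι → ℝ} {α : ℝ} (hα : 0 ≤ α)
    (hν : ∀ i, ν i ≤ -α) :
    ∃ S : ℝ → H →L[ℝ] H, IsC0Semigroup S ∧
      IsGeneratorOf (fun x z => ∀ i, inner ℝ (b i) z = ν i * inner ℝ (b i) x) S ∧
      (∀ t, 0 ≤ t → ‖S t‖ ≤ Real.exp (-α * t)) ∧
      ∀ t, 0 ≤ t → ∀ x i, inner ℝ (b i) (S t x) = Real.exp (ν i * t) * inner ℝ (b i) x := by
  have key : ∀ t : ℝ, ∃ T : H →L[ℝ] H, 0 ≤ t → ‖T‖ ≤ Real.exp (-α * t) ∧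
      ∀ x i, inner ℝ (b i) (T x) = Real.exp (ν i * t) * inner ℝ (b i) x := by
    intro t
    by_cases ht : 0 ≤ t
    · obtain ⟨T, hT⟩ := b.exists_diagonal (m := fun i => Real.exp (ν i * t))
        (Real.exp_pos (-α * t)).le (fun i => by
          rw [abs_of_pos (Real.exp_pos _)]
          exact Real.exp_le_exp.2 (mul_le_mul_of_nonneg_right (hν i) ht))
      exact ⟨T, fun _ => hT⟩
    · exact ⟨0, fun h => absurd h ht⟩
  choose S hS using key
  have hSi : ∀ t, 0 ≤ t → ∀ x i,
      inner ℝ (b i) (S t x) = Real.exp (ν i * t) * inner ℝ (b i) x := fun t ht => (hS t ht).2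
  have hν0 : ∀ i, ν i ≤ 0 := fun i => (hν i).trans (by linarith)
  refine ⟨S, ⟨?_, ?_, ?_⟩, ?_, fun t ht => (hS t ht).1, hSi⟩
  · ext x
    exact b.ext_inner fun i => by simp [hSi 0 le_rfl]
  · intro s t hs ht
    ext x
    refine b.ext_inner fun i => ?_
    rw [ContinuousLinearMap.comp_apply, hSi _ (add_nonneg hs ht), hSi s hs, hSi t ht, mul_add,
      Real.exp_add, mul_assoc]
  · intro x
    rw [← tendsto_sub_nhds_zero_iff]
    refine b.tendsto_zero_of_inner (C := 1) x (fun i => ?_) ?_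
    · have h1 : Tendsto (fun t : ℝ => (Real.exp (ν i * t) - 1) * inner ℝ (b i) x) (𝓝[>] 0)
          (𝓝 ((Real.exp (ν i * 0) - 1) * inner ℝ (b i) x)) :=
        (Continuous.tendsto (by fun_prop) 0).mono_left nhdsWithin_le_nhds
      simp only [mul_zero, Real.exp_zero, sub_self, zero_mul] at h1
      refine h1.congr' ?_
      filter_upwards [self_mem_nhdsWithin] with t ht
      rw [inner_sub_right, hSi t (le_of_lt ht)]
      ring
    · filter_upwards [self_mem_nhdsWithin] with t ht i
      have h1 : Real.exp (ν i * t) ≤ 1 :=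
        Real.exp_le_one_iff.2 (mul_nonpos_of_nonpos_of_nonneg (hν0 i) (le_of_lt ht))
      have h2 := Real.exp_pos (ν i * t)
      rw [inner_sub_right, hSi t (le_of_lt ht), ← sub_one_mul, abs_mul]
      refine mul_le_mul_of_nonneg_right ?_ (abs_nonneg _)
      rw [abs_le]
      constructor <;> linarith
  · have hq : ∀ x i, ∀ t ∈ Ioi (0 : ℝ), inner ℝ (b i) (t⁻¹ • (S t x - x))
        = t⁻¹ * (Real.exp (ν i * t) - 1) * inner ℝ (b i) x := by
      intro x i t ht
      rw [real_inner_smul_right, inner_sub_right, hSi t (le_of_lt ht)]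
      ring
    have hlim : ∀ x i, Tendsto (fun t : ℝ => inner ℝ (b i) (t⁻¹ • (S t x - x))) (𝓝[>] 0)
        (𝓝 (ν i * inner ℝ (b i) x)) := fun x i =>
      ((tendsto_inv_mul_exp_sub_one (ν i)).mul_const _).congr' <| by
        filter_upwards [self_mem_nhdsWithin] with t ht
        rw [hq x i t ht]
    intro x z
    constructor
    · intro h
      rw [← tendsto_sub_nhds_zero_iff]
      -- Each coefficient of the difference quotient minus $z$ is at most $2|\nu_i x_i| = 2|z_i|$,
      -- so $z$ itself is the dominating vector.
      refine b.tendsto_zero_of_inner (C := 2) z (fun i => ?_) ?_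
      · simp only [inner_sub_right _ _ z]
        rw [h i]
        simpa using (hlim x i).sub_const (ν i * inner ℝ (b i) x)
      · filter_upwards [self_mem_nhdsWithin] with t ht i
        rw [inner_sub_right, hq x i t ht, h i, ← sub_mul, abs_mul, abs_mul, ← mul_assoc]
        refine mul_le_mul_of_nonneg_right ?_ (abs_nonneg _)
        have := abs_inv_mul_exp_sub_one_le (hν0 i) ht
        refine (abs_sub _ _).trans ?_
        linarith
    · intro h i
      exact tendsto_nhds_unique (((continuous_const.inner continuous_id).tendsto z).comp h)
        (hlim x i)

theorem IsC0Semigroup.conj {S : ℝ → H →L[ℝ] H} (hS : IsC0Semigroup S) (V : H ≃L[ℝ] H) :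
    IsC0Semigroup fun t => ((V : H →L[ℝ] H).comp (S t)).comp (V.symm : H →L[ℝ] H) where
  map_zero := by
    ext x
    simp [hS.map_zero]
  map_add s t hs ht := by
    ext x
    simp [hS.map_add s t hs ht]
  tendsto_zero x := by
    have := (V.continuous.tendsto _).comp (hS.tendsto_zero (V.symm x))
    simpa [Function.comp_def] using this

theorem IsGeneratorOf.conj {G : H → H → Prop} {S : ℝ → H →L[ℝ] H} (hG : IsGeneratorOf G S)
    (V : H ≃L[ℝ] H) :
    IsGeneratorOf (fun x z => G (V.symm x) (V.symm z))
      fun t => ((V : H →L[ℝ] H).comp (S t)).comp (V.symm : H →L[ℝ] H) := by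
  intro x z
  refine (hG _ _).trans ?_
  have e : ∀ t : ℝ, t⁻¹ • (((V : H →L[ℝ] H).comp (S t)).comp (V.symm : H →L[ℝ] H) x - x)
      = V (t⁻¹ • (S t (V.symm x) - V.symm x)) := fun t => by simp
  simp only [e]
  constructor
  · intro h
    simpa [Function.comp_def] using (V.continuous.tendsto _).comp h
  · intro h
    simpa [Function.comp_def] using (V.symm.continuous.tendsto _).comp h

end Diagonal

/-! ### Laplace transform and resolvent of a decaying semigroup -/

section Resolvent

variable {X : Type*} [NormedAddCommGroup X] [InnerProductSpace ℝ X]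

/-- Factoring out $S(\min(s,t))$ reduces continuity of orbits at every time to right continuity at
$0$. -/
theorem IsC0Semigroup.norm_apply_sub_apply_le {S : ℝ → X →L[ℝ] X} (hS : IsC0Semigroup S) {M : ℝ}
    (hM : ∀ t, 0 ≤ t → ‖S t‖ ≤ M) (y : X) {s t : ℝ} (hs : 0 ≤ s) (ht : 0 ≤ t) :
    ‖S t y - S s y‖ ≤ M * ‖S |t - s| y - y‖ := by
  wlog h : s ≤ t generalizing s t
  · rw [norm_sub_rev, abs_sub_comm]
    exact this ht hs (le_of_not_ge h)
  have e : S t y = S s (S (t - s) y) := by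
    rw [← ContinuousLinearMap.comp_apply, ← hS.map_add s (t - s) hs (by linarith)]
    simp
  rw [abs_of_nonneg (by linarith), e, ← map_sub]
  exact (S s).le_of_opNorm_le (hM s hs) _

theorem IsC0Semigroup.continuousOn {S : ℝ → X →L[ℝ] X} (hS : IsC0Semigroup S) {M : ℝ}
    (hM : ∀ t, 0 ≤ t → ‖S t‖ ≤ M) (y : X) : ContinuousOn (fun t => S t y) (Ici 0) := by
  have h0 : Tendsto (fun t => S t y) (𝓝[≥] 0) (𝓝 y) := by
    have : ContinuousWithinAt (fun t => S t y) (Ioi 0) 0 := by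
      simpa [ContinuousWithinAt, hS.map_zero] using hS.tendsto_zero y
    simpa [ContinuousWithinAt, hS.map_zero] using continuousWithinAt_Ioi_iff_Ici.1 this
  intro s hs
  have ha : Tendsto (fun t : ℝ => |t - s|) (𝓝[Ici 0] s) (𝓝[≥] 0) := by
    refine tendsto_nhdsWithin_iff.2 ⟨?_, Eventually.of_forall fun t => mem_Ici.2 (abs_nonneg _)⟩
    have : Tendsto (fun t : ℝ => |t - s|) (𝓝 s) (𝓝 |s - s|) :=
      Continuous.tendsto (by fun_prop) s
    rw [sub_self, abs_zero] at this
    exact this.mono_left nhdsWithin_le_nhds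
  have hlim : Tendsto (fun t => M * ‖S |t - s| y - y‖) (𝓝[Ici 0] s) (𝓝 0) := by
    have := ((h0.comp ha).sub_const y).norm.const_mul M
    simpa using this
  rw [ContinuousWithinAt, tendsto_iff_norm_sub_tendsto_zero]
  refine squeeze_zero' (Eventually.of_forall fun t => norm_nonneg _) ?_ hlim
  filter_upwards [self_mem_nhdsWithin] with t ht
  exact hS.norm_apply_sub_apply_le hM y hs ht

variable [CompleteSpace X]

/-- Every `r > -α` is in the resolvent set of the generator of a semigroup of decay rate `α`: the
equation `(r - A) x = y` is solved by the Laplace transform of the orbit of `y`. -/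
theorem IsC0Semigroup.exists_resolvent {S : ℝ → X →L[ℝ] X} (hS : IsC0Semigroup S) {C α r : ℝ}
    (hα : 0 ≤ α) (hC : 0 ≤ C) (hdecay : ∀ t, 0 ≤ t → ‖S t‖ ≤ C * Real.exp (-α * t)) (hr : -α < r)
    (y : X) : ∃ x : X, Tendsto (fun t : ℝ => t⁻¹ • (S t x - x)) (𝓝[>] 0) (𝓝 (r • x - y)) := by
  have hM : ∀ t, 0 ≤ t → ‖S t‖ ≤ C := fun t ht => (hdecay t ht).trans <|
    mul_le_of_le_one_right hC (Real.exp_le_one_iff.2 (by nlinarith))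
  -- Cutting off at `max s 0` makes the integrand continuous on the whole line, since `S` is
  -- arbitrary at negative times.
  set f : ℝ → X := fun s => Real.exp (-r * s) • S (max s 0) y with hf
  have hfc : Continuous f := by
    have : Continuous fun s : ℝ => S (max s 0) y :=
      (hS.continuousOn hM y).comp_continuous (by fun_prop) fun s => le_max_right s 0
    exact (by fun_prop : Continuous fun s : ℝ => Real.exp (-r * s)).smul this
  have hfi : IntegrableOn f (Ioi 0) := by
    have hexp := (integrableOn_exp_mul_Ioi (a := -(r + α)) (by linarith) 0).const_mul (C * ‖y‖)
    refine hexp.mono' hfc.aestronglyMeasurable ?_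
    filter_upwards [ae_restrict_mem measurableSet_Ioi] with s hs
    have hs' : 0 ≤ s := le_of_lt hs
    rw [hf]
    simp only
    rw [norm_smul, max_eq_left hs', Real.norm_eq_abs, abs_of_pos (Real.exp_pos _)]
    have h1 := (S s).le_of_opNorm_le (hdecay s hs') y
    calc Real.exp (-r * s) * ‖S s y‖ ≤ Real.exp (-r * s) * (C * Real.exp (-α * s) * ‖y‖) := by
          gcongr
      _ = C * ‖y‖ * Real.exp (-(r + α) * s) := by
          rw [show -(r + α) * s = -r * s + -α * s by ring, Real.exp_add]
          ring
  set x : X := ∫ s in Ioi 0, f s with hx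
  refine ⟨x, ?_⟩
  -- By the semigroup law and a translation, $S(t)x = e^{rt}\int_t^\infty f$.
  have hSx : ∀ t, 0 < t → S t x = Real.exp (r * t) • (x - ∫ s in (0 : ℝ)..t, f s) := by
    intro t ht
    rw [← intervalIntegral.integral_Ioi_sub_Ioi hfi ht.le, ← hx, sub_sub_cancel, hx,
      ← ContinuousLinearMap.integral_comp_comm _ hfi, ← integral_smul]
    have := (measurePreserving_add_right volume t).setIntegral_preimage_emb
      (measurableEmbedding_addRight t) (fun s => Real.exp (r * t) • f s) (Ioi t)
    rw [← this, preimage_add_const_Ioi, sub_self]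
    refine setIntegral_congr_fun measurableSet_Ioi fun s hs => ?_
    have hs' : 0 ≤ s := le_of_lt hs
    simp only [hf]
    rw [max_eq_left hs', max_eq_left (by linarith), map_smul, add_comm s t,
      hS.map_add t s ht.le hs', smul_smul, ← Real.exp_add, ContinuousLinearMap.comp_apply]
    congr 2
    ring
  have hF : Tendsto (fun t : ℝ => t⁻¹ • ∫ s in (0 : ℝ)..t, f s) (𝓝[>] 0) (𝓝 y) := by
    have h := (hfc.integral_hasStrictDerivAt 0 0).hasDerivAt.tendsto_slope_zero_right
    simpa [hf, hS.map_zero] using h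
  have hE : Tendsto (fun t : ℝ => Real.exp (r * t)) (𝓝[>] 0) (𝓝 1) := by
    have : Tendsto (fun t : ℝ => Real.exp (r * t)) (𝓝 0) (𝓝 (Real.exp (r * 0))) :=
      Continuous.tendsto (by fun_prop) 0
    rw [mul_zero, Real.exp_zero] at this
    exact this.mono_left nhdsWithin_le_nhds
  -- The quotient splits as $t^{-1}(e^{rt}-1)x - e^{rt}\,t^{-1}\int_0^t f$, whose limit is $rx -
  -- f(0) = rx - y$.
  have hlim := ((tendsto_inv_mul_exp_sub_one r).smul_const x).sub (hE.smul hF)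
  rw [one_smul] at hlim
  refine hlim.congr' ?_
  filter_upwards [self_mem_nhdsWithin] with t ht
  rw [hSx t ht]
  module

end Resolvent

/-! ### The obstruction at a rational point -/

namespace PointHeat

/-- An eigenfunction that vanishes at `x₀` cannot be stabilized faster than its own rate. -/
theorem not_isStabilizingFeedback {c : ℝ} {x₀ : Ioo (0 : ℝ) 1} {n : ℕ} (hn : sine n x₀ = 0)
    {α : ℝ} (hα : 0 ≤ α) (hr : -α < eigenvalue c n) (K : State →ₗ.[ℝ] ℝ) (S : ℝ → State →L[ℝ] State) :
    ¬ IsStabilizingFeedback (heatOp c) (pointControl c x₀) α K S := by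
  intro h
  obtain ⟨C, hC, hdecay⟩ := h.decay
  obtain ⟨x, hx⟩ := h.semigroup.exists_resolvent hα hC.le hdecay hr (mode n)
  obtain ⟨_, hx'⟩ := isClosedLoop_iff.1 ((h.generator _ _).2 hx)
  have := hx' n
  -- With $r = \lambda_n$ the $n$-th coordinate reads $\lambda_n x_n = \lambda_n x_n - 1$.
  rw [hn, inner_sub_right, real_inner_smul_right, inner_mode_self] at this
  linarith

theorem exists_sine_eq_zero_of_not_irrational {x₀ : ℝ} (h : ¬ Irrational x₀) :
    ∃ n, sine n x₀ = 0 := by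
  rw [irrational_iff_ne_rational] at h
  push Not at h
  obtain ⟨a, b, hb, hab⟩ := h
  -- For $x_0 = a/b$ the frequency $|b|$ works; indexing starts at $0$, hence the shift by one.
  refine ⟨b.natAbs - 1, ?_⟩
  have hb1 : 1 ≤ b.natAbs := Int.natAbs_pos.2 hb
  have e : ((b.natAbs - 1 : ℕ) : ℝ) + 1 = |(b : ℝ)| := by
    rw [Nat.cast_sub hb1, Nat.cast_natAbs]
    simp
  have hb' : (b : ℝ) ≠ 0 := by exact_mod_cast hb
  rw [sine, e, hab]
  refine mul_eq_zero_of_right _ ?_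
  rcases abs_choice (b : ℝ) with h | h <;> rw [h]
  · rw [show (b : ℝ) * Real.pi * (a / b) = a * Real.pi by field_simp, Real.sin_int_mul_pi]
  · rw [show -(b : ℝ) * Real.pi * (a / b) = -(a * Real.pi) by field_simp, Real.sin_neg,
      Real.sin_int_mul_pi, neg_zero]

theorem sine_ne_zero_of_irrational {x₀ : ℝ} (h : Irrational x₀) (n : ℕ) : sine n x₀ ≠ 0 := by
  intro h0
  have hs : Real.sin ((n + 1) * Real.pi * x₀) = 0 := by
    rcases mul_eq_zero.1 h0 with h0 | h0
    · exact absurd h0 (by positivity)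
    · exact h0
  obtain ⟨k, hk⟩ := Real.sin_eq_zero_iff.1 hs
  have hpi := Real.pi_pos.ne'
  have hk' : x₀ = (k : ℝ) / ((n + 1 : ℤ) : ℝ) := by
    push_cast
    rw [eq_div_iff (by positivity)]
    have : ((k : ℝ) - (n + 1) * x₀) * Real.pi = 0 := by linear_combination hk
    linarith [(mul_eq_zero.1 this).resolve_right hpi]
  exact (irrational_iff_ne_rational x₀).1 h k (n + 1) (by positivity) hk'

end PointHeat

/-! ### Cauchy systems -/

/-- Clearing denominators turns $\sum_j a_j/(x-m_j)$ into a polynomial of degree less than $N$ that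
vanishes at the $N$ points $l_i$, hence is zero. Its value at $m_j$ is a nonzero multiple of $a_j$.
-/
theorem eq_zero_of_sum_div_sub_eq_zero {N : ℕ} {l m : Fin N → ℝ} (hl : Function.Injective l)
    (hm : Function.Injective m) (hne : ∀ i j, l i ≠ m j) {a : Fin N → ℝ}
    (h : ∀ i, ∑ j, a j / (l i - m j) = 0) : a = 0 := by
  classical
  let P : Polynomial ℝ :=
    ∑ j, Polynomial.C (a j) * Lagrange.nodal (Finset.univ.erase j) m
  have hev : ∀ x, P.eval x = ∑ j, a j * ∏ k ∈ Finset.univ.erase j, (x - m k) := fun x => by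
    simp [P, Polynomial.eval_finsetSum, Lagrange.eval_nodal]
  have hdeg : P.degree < (Finset.univ : Finset (Fin N)).card := by
    rw [← Polynomial.mem_degreeLT]
    refine Submodule.sum_mem _ fun j _ => ?_
    rw [← Polynomial.smul_eq_C_mul]
    refine Submodule.smul_mem _ _ (Polynomial.mem_degreeLT.2 ?_)
    rw [Lagrange.degree_nodal]
    exact_mod_cast Finset.card_erase_lt_of_mem (Finset.mem_univ j)
  have hP : P = 0 := by
    refine Polynomial.eq_zero_of_degree_lt_of_eval_index_eq_zero Finset.univ hl.injOn hdeg
      fun i _ => ?_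
    have e : ∀ j, a j * ∏ k ∈ Finset.univ.erase j, (l i - m k)
        = (∏ k, (l i - m k)) * (a j / (l i - m j)) := fun j => by
      rw [← Finset.mul_prod_erase _ _ (Finset.mem_univ j)]
      have := sub_ne_zero.2 (hne i j)
      field_simp
    rw [hev]
    simp only [e]
    rw [← Finset.mul_sum, h i, mul_zero]
  funext j
  have h0 := hev (m j)
  rw [hP, Polynomial.eval_zero, Finset.sum_eq_single j] at h0
  · refine (mul_eq_zero.1 h0.symm).resolve_right (Finset.prod_ne_zero_iff.2 fun k hk => ?_)
    exact sub_ne_zero.2 fun hk' => (Finset.mem_erase.1 hk).1 (hm hk').symm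
  · intro i _ hij
    rw [Finset.prod_eq_zero (Finset.mem_erase.2 ⟨hij.symm, Finset.mem_univ j⟩) (sub_self _),
      mul_zero]
  · simp

theorem exists_sum_div_sub_eq {N : ℕ} {l m : Fin N → ℝ} (hl : Function.Injective l)
    (hm : Function.Injective m) (hne : ∀ i j, l i ≠ m j) (y : Fin N → ℝ) :
    ∃ a : Fin N → ℝ, ∀ i, ∑ j, a j / (l i - m j) = y i := by
  let T : (Fin N → ℝ) →ₗ[ℝ] (Fin N → ℝ) :=
    { toFun := fun a i => ∑ j, a j / (l i - m j)
      map_add' := fun a b => by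
        funext i
        simp [add_div, Finset.sum_add_distrib]
      map_smul' := fun r a => by
        funext i
        simp [mul_div_assoc, Finset.mul_sum] }
  have hT : Function.Injective T := (injective_iff_map_eq_zero T).2 fun a ha =>
    eq_zero_of_sum_div_sub_eq_zero hl hm hne fun i => congrFun ha i
  obtain ⟨a, ha⟩ := LinearMap.injective_iff_surjective.1 hT y
  exact ⟨a, fun i => congrFun ha i⟩

/-! ### Modal feedback -/

section Modal

variable {H : Type*} [NormedAddCommGroup H] [InnerProductSpace ℝ H]

/-- In the modal coordinates `p`, `q` of `x`, `z`, the relation `z = (A + B K) x` is diagonal. -/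
theorem HilbertBasis.modal_iff (b : HilbertBasis ℕ ℝ H) (N : ℕ) {l m β : ℕ → ℝ}
    (hl : Function.Injective l) (hm : Function.Injective m) (hne : ∀ i j, l i ≠ m j)
    (hβ : ∀ n, β n ≠ 0) {V : H → H} (hV : ∀ p n, inner ℝ (b n) (V p)
      = ∑ j : Fin N, inner ℝ (b j) p * (β n / (l n - m j))
        + if n < N then 0 else inner ℝ (b n) p) (p q : H) :
    (∀ n, inner ℝ (b n) q = (if n < N then m n else l n) * inner ℝ (b n) p) ↔
      ∀ n, l n * inner ℝ (b n) (V p) + (-∑ j : Fin N, inner ℝ (b j) p) * β n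
        = inner ℝ (b n) (V q) := by
  -- The defect of the closed-loop equation is a Cauchy sum in $q_j - m_jp_j$ plus the tail defect
  -- $q_n - l_np_n$. This rests on $l/(l-m) - 1 = m/(l-m)$, the eigenvector equation of $w_j$.
  have key : ∀ n, inner ℝ (b n) (V q)
      - (l n * inner ℝ (b n) (V p) + (-∑ j : Fin N, inner ℝ (b j) p) * β n)
      = β n * (∑ j : Fin N, (inner ℝ (b j) q - m j * inner ℝ (b j) p) / (l n - m j))
        + if n < N then 0 else inner ℝ (b n) q - l n * inner ℝ (b n) p := by
    intro n
    have e : β n * (∑ j : Fin N, (inner ℝ (b j) q - m j * inner ℝ (b j) p) / (l n - m j))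
        = ∑ j : Fin N, inner ℝ (b j) q * (β n / (l n - m j))
          - l n * ∑ j : Fin N, inner ℝ (b j) p * (β n / (l n - m j))
          + (∑ j : Fin N, inner ℝ (b j) p) * β n := by
      rw [Finset.mul_sum, Finset.mul_sum, Finset.sum_mul, ← Finset.sum_sub_distrib,
        ← Finset.sum_add_distrib]
      refine Finset.sum_congr rfl fun j _ => ?_
      have := sub_ne_zero.2 (hne n j)
      field_simp
      ring
    rw [hV, hV, e]
    split_ifs <;> ring
  constructor
  · intro h n
    refine (sub_eq_zero.1 ((key n).trans ?_)).symm
    rw [Finset.sum_eq_zero fun j _ => by rw [h j, if_pos j.2, sub_self, zero_div], mul_zero,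
      zero_add]
    split_ifs with hn
    · rfl
    · rw [h n, if_neg hn, sub_self]
  · intro h
    have h0 : ∀ n, β n * (∑ j : Fin N, (inner ℝ (b j) q - m j * inner ℝ (b j) p) / (l n - m j))
        + (if n < N then 0 else inner ℝ (b n) q - l n * inner ℝ (b n) p) = 0 := fun n => by
      rw [← key, h n, sub_self]
    -- The equations with $n < N$ form a Cauchy system without tail, which kills the first $N$
    -- defects; the tail equations then decouple.
    have ha : (fun j : Fin N => inner ℝ (b j) q - m j * inner ℝ (b j) p) = 0 := by
      refine eq_zero_of_sum_div_sub_eq_zero (hl.comp Fin.val_injective)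
        (hm.comp Fin.val_injective) (fun i j => hne i j) fun i => ?_
      have := h0 i
      rw [if_pos i.2, add_zero] at this
      exact (mul_eq_zero.1 this).resolve_left (hβ i)
    intro n
    by_cases hn : n < N
    · rw [if_pos hn]
      exact sub_eq_zero.1 (congrFun ha ⟨n, hn⟩)
    · have := h0 n
      rw [Finset.sum_eq_zero fun j _ => by
        rw [show inner ℝ (b j) q - m j * inner ℝ (b j) p = (0 : ℝ) from congrFun ha j, zero_div],
        mul_zero, zero_add, if_neg hn] at this
      rw [if_neg hn]
      exact sub_eq_zero.1 this

/-- If `w j` has the coefficients `β n / (l n - m j)` in the basis `b`, then replacing the first `N`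
vectors `b j` by `w j` is an isomorphism. -/
theorem HilbertBasis.exists_modal_equiv [CompleteSpace H] (b : HilbertBasis ℕ ℝ H) (N : ℕ)
    {l m β : ℕ → ℝ}
    (hl : Function.Injective l) (hm : Function.Injective m) (hne : ∀ i j, l i ≠ m j)
    (hβ : ∀ n, β n ≠ 0) {w : ℕ → H} (hw : ∀ j n, inner ℝ (b n) (w j) = β n / (l n - m j)) :
    ∃ V : H ≃L[ℝ] H, ∀ p n, inner ℝ (b n) (V p)
      = ∑ j : Fin N, inner ℝ (b j) p * (β n / (l n - m j))
        + if n < N then 0 else inner ℝ (b n) p := by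
  have hlN : Function.Injective fun i : Fin N => l i := hl.comp Fin.val_injective
  have hmN : Function.Injective fun i : Fin N => m i := hm.comp Fin.val_injective
  have horth : ∀ i j, inner ℝ (b i) (b j) = if i = j then (1 : ℝ) else 0 :=
    orthonormal_iff_ite.1 b.orthonormal
  have hdelta : ∀ (a : ℕ → ℝ) (n : ℕ),
      ∑ j : Fin N, a j * (if n = j then (1 : ℝ) else 0) = if n < N then a n else 0 := by
    intro a n
    rw [Fin.sum_univ_eq_sum_range (fun j => a j * (if n = j then (1 : ℝ) else 0)) N]
    simp
  let L : H →L[ℝ] H := ContinuousLinearMap.id ℝ H +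
    ∑ j : Fin N, (innerSL ℝ (b j)).smulRight (w j - b j)
  have hL : ∀ p n, inner ℝ (b n) (L p)
      = ∑ j : Fin N, inner ℝ (b j) p * (β n / (l n - m j))
        + if n < N then 0 else inner ℝ (b n) p := by
    intro p n
    have e : L p = p + ∑ j : Fin N, (inner ℝ (b j) p : ℝ) • (w j - b j) := by
      simp [L]
    rw [e, inner_add_right, inner_sum]
    simp only [real_inner_smul_right, inner_sub_right, hw, horth, mul_sub,
      Finset.sum_sub_distrib]
    rw [hdelta (fun j => inner ℝ (b j) p) n]
    split_ifs <;> ring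
  have hinj : L.ker = ⊥ := by
    refine LinearMap.ker_eq_bot'.2 fun p hp => ?_
    have hp0 : ∀ n, ∑ j : Fin N, inner ℝ (b j) p * (β n / (l n - m j))
        + (if n < N then 0 else inner ℝ (b n) p) = 0 := fun n => by
      rw [← hL, show L p = 0 from hp, inner_zero_right]
    have ha : (fun j : Fin N => (inner ℝ (b j) p : ℝ)) = 0 := by
      refine eq_zero_of_sum_div_sub_eq_zero hlN hmN (fun i j => hne i j) fun i => ?_
      have := hp0 i
      rw [if_pos i.2, add_zero] at this
      refine (mul_eq_zero.1 (?_ : β i * _ = 0)).resolve_left (hβ i)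
      rw [← this, Finset.mul_sum]
      exact Finset.sum_congr rfl fun j _ => by ring
    refine b.ext_inner fun n => ?_
    rw [inner_zero_right]
    by_cases hn : n < N
    · exact congrFun ha ⟨n, hn⟩
    · have := hp0 n
      rw [if_neg hn, Finset.sum_eq_zero fun j _ => by
        rw [show inner ℝ (b j) p = (0 : ℝ) from congrFun ha j, zero_mul], zero_add] at this
      exact this
  have hsurj : L.range = ⊤ := by
    refine LinearMap.range_eq_top.2 fun y => ?_
    obtain ⟨a, ha⟩ := exists_sum_div_sub_eq hlN hmN (fun i j => hne i j)
      (fun i => inner ℝ (b i) y / β i)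
    let a' : ℕ → ℝ := fun n => if hn : n < N then a ⟨n, hn⟩ else 0
    have ha' : ∀ j : Fin N, a' j = a j := fun j => by simp [a']
    have hsum : ∀ n, n < N → ∑ j : Fin N, a' j * (β n / (l n - m j)) = inner ℝ (b n) y := by
      intro n hn
      have := ha ⟨n, hn⟩
      simp only at this
      rw [eq_div_iff (hβ n), Finset.sum_mul] at this
      rw [← this]
      refine Finset.sum_congr rfl fun j _ => ?_
      rw [ha']
      ring
    -- Since $Lp = p + \sum_j \langle b_j,p\rangle(w_j-b_j)$, this $p$ is a preimage of $y$ as soon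
    -- as $\langle b_j,p\rangle = a_j$ for $j < N$, which is the Cauchy system solved by `a`.
    let p : H := y - ∑ j : Fin N, a' j • (w j - b j)
    have hp : ∀ n, inner ℝ (b n) p = inner ℝ (b n) y
        - ∑ j : Fin N, a' j * (β n / (l n - m j)) + if n < N then a' n else 0 := by
      intro n
      simp only [p, inner_sub_right, inner_sum, real_inner_smul_right, hw, horth, mul_sub,
        Finset.sum_sub_distrib]
      rw [hdelta a' n]
      ring
    have hpN : ∀ j : Fin N, inner ℝ (b j) p = a' j := fun j => by
      rw [hp, hsum j j.2, if_pos j.2]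
      ring
    refine ⟨p, b.ext_inner fun n => ?_⟩
    change inner ℝ (b n) (L p) = _
    rw [hL]
    simp only [hpN]
    split_ifs with hn
    · rw [hsum n hn, add_zero]
    · rw [hp, if_neg hn]
      ring
  exact ⟨ContinuousLinearEquiv.ofBijective L hinj hsurj, hL⟩

end Modal

/-! ### Construction of the stabilizing feedback -/

namespace PointHeat

theorem exists_eigenvalue_le (c α : ℝ) : ∃ N : ℕ, ∀ n, N ≤ n → eigenvalue c n ≤ -α := by
  obtain ⟨N, hN⟩ := exists_nat_ge (c + α)
  refine ⟨N, fun n hn => ?_⟩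
  have hn' : (N : ℝ) ≤ n := by exact_mod_cast hn
  have hpi : 1 ≤ Real.pi := by linarith [Real.pi_gt_three]
  have h1 : (n : ℝ) + 1 ≤ (n + 1) * Real.pi := by nlinarith
  unfold eigenvalue
  nlinarith

/-- The spectrum is countable, so each interval $(-\alpha-j-1,-\alpha-j)$ contains a point outside
it. -/
theorem exists_strictAnti_ne_eigenvalue (c α : ℝ) :
    ∃ m : ℕ → ℝ, StrictAnti m ∧ (∀ j, m j ≤ -α) ∧ ∀ n j, eigenvalue c n ≠ m j := by
  have hd : Dense (range (eigenvalue c))ᶜ := (countable_range _).dense_compl ℝ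
  have key : ∀ j : ℕ, ∃ z ∈ (range (eigenvalue c))ᶜ, z ∈ Ioo (-α - (j + 1 : ℝ)) (-α - j) :=
    fun j => hd.exists_between (by linarith)
  choose m hm hmj using key
  refine ⟨m, strictAnti_nat_of_succ_lt fun j => ?_, fun j => ?_, fun n j h => hm j ⟨n, h⟩⟩
  · have := (hmj (j + 1)).2
    push_cast at this
    exact this.trans_le (hmj j).1.le
  · have := (hmj j).2
    have h0 : (0 : ℝ) ≤ j := by positivity
    linarith

theorem abs_sine_le (n : ℕ) (x : ℝ) : |sine n x| ≤ √2 := by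
  rw [sine, abs_mul, abs_of_nonneg (Real.sqrt_nonneg 2)]
  exact mul_le_of_le_one_right (Real.sqrt_nonneg 2) (Real.abs_sin_le_one _)

/-- The numerators are bounded and the denominators grow quadratically. This puts the new
eigenvectors $w_j$ in $L^2(0,1)$, although the Dirac mass lies only in $X_{-1}$. -/
theorem summable_sq_sine_div (c r x : ℝ) :
    Summable fun n => (sine n x / (eigenvalue c n - r)) ^ 2 := by
  have hg : Summable fun n : ℕ => 2 * (1 / ((n + 1 : ℕ) : ℝ) ^ 2) :=
    ((summable_nat_add_iff 1).2 (Real.summable_one_div_nat_pow.2 one_lt_two)).mul_left 2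
  refine Summable.of_norm_bounded_eventually_nat hg ?_
  obtain ⟨N, hN⟩ := exists_nat_ge |c - r|
  filter_upwards [eventually_ge_atTop N] with n hn
  have hn' : (N : ℝ) ≤ n := by exact_mod_cast hn
  have hpi := Real.pi_gt_three
  have h0 : (0 : ℝ) ≤ n := by positivity
  have h1 : ((n : ℝ) + 1) * 3 ≤ (n + 1) * Real.pi := by nlinarith
  have h2 : (n : ℝ) + 1 ≤ |eigenvalue c n - r| := by
    rw [abs_sub_comm, eigenvalue]
    refine le_trans ?_ (le_abs_self _)
    have := le_abs_self (c - r)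
    nlinarith
  have h3 := abs_sine_le n x
  rw [Real.norm_eq_abs, abs_pow, abs_div, div_pow]
  push_cast
  have h4 : |sine n x| ^ 2 ≤ 2 := by
    have := pow_le_pow_left₀ (abs_nonneg _) h3 2
    rwa [Real.sq_sqrt (by norm_num)] at this
  rw [← mul_div_assoc, mul_one]
  gcongr

theorem memLp_exp_neg {α : ℝ} (hα : 0 < α) :
    MemLp (fun t : ℝ => Real.exp (-α * t)) 2 (volume.restrict (Ioi 0)) := by
  rw [memLp_two_iff_integrable_sq (by fun_prop)]
  have := integrableOn_exp_mul_Ioi (a := -(2 * α)) (by linarith) 0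
  refine this.congr_fun (fun t _ => ?_) measurableSet_Ioi
  simp only
  rw [← Real.exp_nat_mul]
  congr 1
  push_cast
  ring

/-- If no eigenfunction vanishes at `x₀`, every decay rate is achieved by a feedback law that moves
finitely many eigenvalues. -/
theorem completelyStabilizable_of_sine_ne_zero {c : ℝ} {x₀ : Ioo (0 : ℝ) 1}
    (h : ∀ n, sine n x₀ ≠ 0) : CompletelyStabilizable (heatOp c) (pointControl c x₀) := by
  intro α hα
  obtain ⟨N, hN⟩ := exists_eigenvalue_le c α
  obtain ⟨m, hm, hmα, hne⟩ := exists_strictAnti_ne_eigenvalue c α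
  have hw : ∀ j, ∃ w : State, ∀ n,
      inner ℝ (modeBasis n) w = sine n x₀ / (eigenvalue c n - m j) := fun j =>
    modeBasis.exists_inner_eq (summable_sq_sine_div c (m j) x₀)
  choose w hw using hw
  have hl := (eigenvalue_strictAnti c).injective
  obtain ⟨V, hV⟩ := modeBasis.exists_modal_equiv N hl hm.injective hne h hw
  have hiff := modeBasis.modal_iff N hl hm.injective hne h hV
  obtain ⟨E, hE, hgen, hnorm, hEi⟩ := modeBasis.exists_semigroup
    (ν := fun n => if n < N then m n else eigenvalue c n) hα.le (fun n => by
      split_ifs with hn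
      · exact hmα n
      · exact hN n (not_lt.1 hn))
  -- Minus the sum of the first $N$ modal coordinates: $-1$ on each $w_j$ and $0$ on the unmoved
  -- eigenvectors. It is bounded on $X$, so `K` can have full domain.
  let k : State →L[ℝ] ℝ :=
    (-∑ j : Fin N, innerSL ℝ (modeBasis j)).comp (V.symm : State →L[ℝ] State)
  have hk : ∀ x, k x = -∑ j : Fin N, inner ℝ (modeBasis j) (V.symm x) := fun x => by simp [k]
  let K : State →ₗ.[ℝ] ℝ := (k : State →ₗ[ℝ] ℝ).toPMap ⊤
  have hK : ∀ x (hx : x ∈ K.domain), K ⟨x, hx⟩ = k x := fun x hx => rfl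
  have hcl : ∀ x z, IsClosedLoop (heatOp c) (pointControl c x₀) K x z ↔
      ∀ n, inner ℝ (modeBasis n) (V.symm z)
        = (if n < N then m n else eigenvalue c n) * inner ℝ (modeBasis n) (V.symm x) := by
    intro x z
    rw [isClosedLoop_iff, hiff]
    simp only [hK, hk, ContinuousLinearEquiv.apply_symm_apply, modeBasis_apply]
    exact ⟨fun ⟨_, h⟩ => h, fun h => ⟨trivial, h⟩⟩
  let S : ℝ → State →L[ℝ] State := fun t =>
    ((V : State →L[ℝ] State).comp (E t)).comp (V.symm : State →L[ℝ] State)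
  let C : ℝ := ‖(V : State →L[ℝ] State)‖ * ‖(V.symm : State →L[ℝ] State)‖ + 1
  have hC : 0 < C := by positivity
  have hSn : ∀ t, 0 ≤ t → ‖S t‖ ≤ C * Real.exp (-α * t) := by
    intro t ht
    calc ‖S t‖ ≤ ‖(V : State →L[ℝ] State)‖ * ‖E t‖ * ‖(V.symm : State →L[ℝ] State)‖ :=
          (ContinuousLinearMap.opNorm_comp_le _ _).trans
            (mul_le_mul_of_nonneg_right (ContinuousLinearMap.opNorm_comp_le _ _) (norm_nonneg _))
      _ ≤ ‖(V : State →L[ℝ] State)‖ * Real.exp (-α * t) * ‖(V.symm : State →L[ℝ] State)‖ := by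
          gcongr
          exact hnorm t ht
      _ ≤ C * Real.exp (-α * t) := by
          have := (Real.exp_pos (-α * t)).le
          simp only [C]
          nlinarith
  refine ⟨K, S, le_top, ⟨‖k‖, fun x hx => ?_⟩, hE.conj V, fun x z => ?_, ⟨C, hC, hSn⟩,
    ⟨‖k‖, fun x z hx _ => ?_⟩, ?_⟩
  · exact (k.le_opNorm x).trans
      (mul_le_mul_of_nonneg_left (le_add_of_nonneg_right (norm_nonneg _)) (norm_nonneg _))
  · exact (hcl x z).trans (hgen.conj V x z)
  · exact (k.le_opNorm x).trans
      (mul_le_mul_of_nonneg_left (le_add_of_nonneg_right (norm_nonneg _)) (norm_nonneg _))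
  · have hexp := memLp_exp_neg hα
    set R : ℝ := (eLpNorm (fun t : ℝ => Real.exp (-α * t)) 2 (volume.restrict (Ioi 0))).toReal
    have hR : eLpNorm (fun t : ℝ => Real.exp (-α * t)) 2 (volume.restrict (Ioi 0))
        = ENNReal.ofReal R := (ENNReal.ofReal_toReal hexp.eLpNorm_ne_top).symm
    have hR0 : 0 ≤ R := ENNReal.toReal_nonneg
    refine ⟨‖k‖ * C * R + 1, by positivity, fun y₀ z₀ _ => ?_⟩
    -- The control is written as an explicit exponential sum, which is visibly measurable; it equals
    -- $KS(t)y_0$ for $t \ge 0$.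
    let u : ℝ → ℝ := fun t =>
      -∑ j : Fin N, Real.exp (m j * t) * inner ℝ (modeBasis j) (V.symm y₀)
    have hu : ∀ t, 0 ≤ t → u t = k (S t y₀) := by
      intro t ht
      simp only [hk, u, S]
      congr 1
      refine Finset.sum_congr rfl fun j _ => ?_
      simp [hEi t ht]
    have hbound : ∀ᵐ t ∂(volume.restrict (Ioi (0 : ℝ))),
        ‖u t‖ ≤ (‖k‖ * C * ‖y₀‖) * ‖Real.exp (-α * t)‖ := by
      filter_upwards [ae_restrict_mem measurableSet_Ioi] with t ht
      have ht' : 0 ≤ t := le_of_lt ht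
      rw [hu t ht', Real.norm_of_nonneg (Real.exp_pos _).le]
      calc ‖k (S t y₀)‖ ≤ ‖k‖ * ‖S t y₀‖ := k.le_opNorm _
        _ ≤ ‖k‖ * (C * Real.exp (-α * t) * ‖y₀‖) := by
            gcongr
            exact (S t).le_of_opNorm_le (hSn t ht') y₀
        _ = _ := by ring
    have humeas : AEStronglyMeasurable u (volume.restrict (Ioi (0 : ℝ))) :=
      Continuous.aestronglyMeasurable (by fun_prop)
    refine ⟨u, fun t ht => ?_, MemLp.of_le_mul hexp humeas hbound, ?_⟩
    · rw [hu t ht]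
      exact K.mem_graph ⟨S t y₀, trivial⟩
    · refine (eLpNorm_le_mul_eLpNorm_of_ae_le_mul hbound 2).trans ?_
      rw [hR, ← ENNReal.ofReal_mul (by positivity)]
      refine ENNReal.ofReal_le_ofReal ?_
      nlinarith [norm_nonneg y₀]

end PointHeat

end

theorem theorem4p5 (c : ℝ) (hc : Real.pi ^ 2 < c) (x₀ : ℝ) (hx₀ : x₀ ∈ Set.Ioo (0 : ℝ) 1) :
    CompletelyStabilizable (PointHeat.heatOp c) (PointHeat.pointControl c ⟨x₀, hx₀⟩) ↔
      Irrational x₀ := by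
  constructor
  · intro h
    by_contra hirr
    obtain ⟨n, hn⟩ := PointHeat.exists_sine_eq_zero_of_not_irrational hirr
    -- A rate that is positive and exceeds $-\lambda_n$ whatever the sign of $\lambda_n$.
    have hα : 0 < |PointHeat.eigenvalue c n| + 1 := by positivity
    have hr : -(|PointHeat.eigenvalue c n| + 1) < PointHeat.eigenvalue c n := by
      linarith [neg_abs_le (PointHeat.eigenvalue c n)]
    obtain ⟨K, S, hKS⟩ := h _ hα
    exact PointHeat.not_isStabilizingFeedback (x₀ := ⟨x₀, hx₀⟩) hn hα.le hr K S hKS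
  · intro h
    exact PointHeat.completelyStabilizable_of_sine_ne_zero (x₀ := ⟨x₀, hx₀⟩)
      (PointHeat.sine_ne_zero_of_irrational h)
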